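/- Let $p>2$ and $0<\theta<1/2$. Let $T$ be a tree on the vertex set $\{1,\dots,p\}$ with edge set $\mathcal E_P$, and let $P$ be a probability distribution on $\{0,1\}^p$ that is a graphical model on $T$, i.e. $P(\mathbf x)=\prod_i P_i(x_i)\prod_{\{i,j\}\in\mathcal E_P}\frac{P_{i,j}(x_i,x_j)}{P_i(x_i)P_j(x_j)}$ with $P_i$, $P_{i,j}$ the marginals of $P$, such that $P_i(0)=P_i(1)=\tfrac12$ for every node $i$ and $P_{i,j}(0,1)=P_{i,j}(1,0)=\theta/2$ for every edge $\{i,j\}\in\mathcal E_P$. Let $\mathcal D(\mathcal T^p,\theta)$ be the set of all distributions of this kind, over all trees on $\{1,\dots,p\}$. For $0\le q<1/2$ let $$P^{(q)}(\mathbf y)=\sum_{\mathbf x\in\{0,1\}^p}q^{\delta_{\mathbf x,\mathbf y}}(1-q)^{p-\delta_{\mathbf x,\mathbf y}}P(\mathbf x)$$ be the law of the output when each component of $\mathbf x\sim P$ is passed through a memoryless binary symmetric channel with crossover probability $q$, where $\delta_{\mathbf x,\mathbf y}$ is the Hamming distance. Let $\mathbf y_1,\mathbf y_2,\dots$ be i.i.d.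 with law $P^{(q)}$, let $\widehat P^{(q)}$ be the empirical distribution of $\mathbf y^n=(\mathbf y_1,\dots,\mathbf y_n)$, with pair marginals $\widehat P^{(q)}_{i,j}$, and put $\widehat A^{(q)}_{i,j}=\widehat P^{(q)}_{i,j}(0,0)+\widehat P^{(q)}_{i,j}(1,1)$. Let $\widehat{\mathcal E}^{(q)}(\mathbf y^n)$ be the edge set of a maximum weight spanning tree of the complete graph on $\{1,\dots,p\}$ in which the edge $\{i,j\}$ has weight $\widehat A^{(q)}_{i,j}$, ties being broken in an arbitrary (possibly random) way. Then the limit $$K_P^{(q)}:=\lim_{n\to\infty}-\frac1n\log\mathbb P\big(\widehat{\mathcal E}^{(q)}(\mathbf y^n)\neq\mathcal E_P\big)$$ exists and $$K_P^{(q)}=-\log\left(1-4\Big(\frac{\beta_1+\beta_2}{2}-\sqrt{\beta_1\beta_2}\Big)\right),$$ where $$\beta_1=\big((1-q)^3+q^3\big)\frac{\theta(1-\theta)}2+q(1-q)\,\frac{1-\theta(1-\theta)}2,\qquad \beta_2=\big((1-q)^3+q^3\big)\frac{\theta^2}2+q(1-q)\,\frac{1-\theta^2}2 .$$ Moreover,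 the value at $q=0$ is the exponent $K_P$ of maximum likelihood learning from noiseless samples: if $\mathbf x_1,\mathbf x_2,\dots$ are i.i.d. with law $P$ and $\mathcal E_{\mathrm{ML}}(\mathbf x^n)$ is the edge set of a maximizer of $\sum_{k=1}^n\log Q(\mathbf x_k)$ over $Q\in\mathcal D(\mathcal T^p,\theta)$ (ties broken arbitrarily), then $$K_P:=\lim_{n\to\infty}-\frac1n\log\mathbb P\big(\mathcal E_{\mathrm{ML}}(\mathbf x^n)\ne\mathcal E_P\big)=K_P^{(0)}=-\log\Big(1-\theta\big(1-\sqrt{4\theta(1-\theta)}\big)\Big).$$ -/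

import Mathlib

open MeasureTheory ProbabilityTheory Filter Topology

noncomputable section

/-- The marginal `Q_i(a)` at node `i` of a function `Q` on `{0,1}^p`. -/
def nodeMarginal {p : ℕ} (Q : (Fin p → Fin 2) → ℝ) (i : Fin p) (a : Fin 2) : ℝ :=
  ∑ x : Fin p → Fin 2 with x i = a, Q x

/-- The marginal `Q_{i,j}(a,b)` on the pair of nodes `(i,j)` of a function `Q` on `{0,1}^p`. -/
def pairMarginal {p : ℕ} (Q : (Fin p → Fin 2) → ℝ) (i j : Fin p) (a b : Fin 2) : ℝ :=
  ∑ x : Fin p → Fin 2 with x i = a ∧ x j = b, Q x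

theorem pairMarginal_comm {p : ℕ} (Q : (Fin p → Fin 2) → ℝ) (i j : Fin p) (a b : Fin 2) :
    pairMarginal Q i j a b = pairMarginal Q j i b a := by
  simp only [pairMarginal, and_comm]

/-- The edge factor `Q_{i,j}(x_i,x_j) / (Q_i(x_i) Q_j(x_j))` of the unordered pair `{i,j}`. -/
def edgeFactor {p : ℕ} (Q : (Fin p → Fin 2) → ℝ) (x : Fin p → Fin 2) : Sym2 (Fin p) → ℝ :=
  Sym2.lift ⟨fun i j =>
    pairMarginal Q i j (x i) (x j) / (nodeMarginal Q i (x i) * nodeMarginal Q j (x j)),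
    fun i j => by
      dsimp only
      rw [pairMarginal_comm, mul_comm (nodeMarginal Q i (x i))]⟩

open Classical in
/-- `P` is a probability mass function on `{0,1}^p` that is a graphical model on the tree `T`,
has uniform node marginals, and satisfies `P_{i,j}(0,1) = P_{i,j}(1,0) = θ/2` on every edge
of `T`. -/
structure IsTreeModel {p : ℕ} (θ : ℝ) (T : SimpleGraph (Fin p))
    (P : (Fin p → Fin 2) → ℝ) : Prop where
  isTree : T.IsTree
  mem_stdSimplex : P ∈ stdSimplex ℝ (Fin p → Fin 2)
  factorizes : ∀ x, P x = (∏ i, nodeMarginal P i (x i)) * ∏ e ∈ T.edgeFinset, edgeFactor P x e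
  uniform : ∀ i a, nodeMarginal P i a = 1 / 2
  homogeneous : ∀ i j, T.Adj i j → pairMarginal P i j 0 1 = θ / 2 ∧ pairMarginal P i j 1 0 = θ / 2

/-- The law of the output when each coordinate of a vector of law `P` is passed
through a memoryless binary symmetric channel with crossover probability `q`. -/
def bscOutput {p : ℕ} (q : ℝ) (P : (Fin p → Fin 2) → ℝ) (y : Fin p → Fin 2) : ℝ :=
  ∑ x : Fin p → Fin 2, q ^ hammingDist x y * (1 - q) ^ (p - hammingDist x y) * P x

/-- The empirical distribution of `n` samples. -/
def empiricalDist {p n : ℕ} (y : Fin n → Fin p → Fin 2) (z : Fin p → Fin 2) : ℝ :=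
  1 / (n : ℝ) * ∑ k : Fin n, if y k = z then 1 else 0

/-- The weight `Â_{i,j} = P̂_{i,j}(0,0) + P̂_{i,j}(1,1)` of the unordered pair `{i,j}`, where `P̂`
is the empirical distribution of the samples. -/
def agreementWeight {p n : ℕ} (y : Fin n → Fin p → Fin 2) : Sym2 (Fin p) → ℝ :=
  Sym2.lift ⟨fun i j =>
    pairMarginal (empiricalDist y) i j 0 0 + pairMarginal (empiricalDist y) i j 1 1,
    fun i j => by
      dsimp only
      rw [pairMarginal_comm _ i j 0 0, pairMarginal_comm _ i j 1 1]⟩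

open Classical in
/-- The total weight of the edges of a graph. -/
def graphWeight {p : ℕ} (w : Sym2 (Fin p) → ℝ) (G : SimpleGraph (Fin p)) : ℝ :=
  ∑ e ∈ G.edgeFinset, w e

/-- `G` is a maximum weight spanning tree of the complete graph on `p` nodes with edge
weights `w`. -/
def IsMWST {p : ℕ} (w : Sym2 (Fin p) → ℝ) (G : SimpleGraph (Fin p)) : Prop :=
  G.IsTree ∧ ∀ G' : SimpleGraph (Fin p), G'.IsTree → graphWeight w G' ≤ graphWeight w G

/-- `G` is the tree of a maximum likelihood estimate, given the samples `x`, in the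
class of all tree models with parameter `θ`. -/
def IsMLTree {p n : ℕ} (θ : ℝ) (x : Fin n → Fin p → Fin 2) (G : SimpleGraph (Fin p)) : Prop :=
  ∃ Q, IsTreeModel θ G Q ∧ ∀ G' Q', IsTreeModel θ G' Q' →
    ∑ k, Real.log (Q' (x k)) ≤ ∑ k, Real.log (Q (x k))

/-- `Y 0, Y 1, …` are independent samples, each of law `D`. -/
structure IsIIDSample {Ω : Type*} [MeasurableSpace Ω] (μ : Measure Ω) {p : ℕ}
    (D : (Fin p → Fin 2) → ℝ) (Y : ℕ → Ω → Fin p → Fin 2) : Prop where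
  measurable : ∀ k, Measurable (Y k)
  indep : iIndepFun Y μ
  law : ∀ k y, μ.real {ω | Y k ω = y} = D y

/-- The error probability `μ(Ê n ≠ T)` of the tree estimates `Ê n` of `T` has exponent `K`. -/
def HasErrorExponent {Ω : Type*} [MeasurableSpace Ω] (μ : Measure Ω) {p : ℕ}
    (T : SimpleGraph (Fin p)) (E : ℕ → Ω → SimpleGraph (Fin p)) (K : ℝ) : Prop :=
  Tendsto (fun n : ℕ => -(1 / (n : ℝ)) * Real.log (μ.real {ω | E n ω ≠ T})) atTop (𝓝 K)

def beta₁ (q θ : ℝ) : ℝ :=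
  ((1 - q) ^ 3 + q ^ 3) * (θ * (1 - θ) / 2) + q * (1 - q) * ((1 - θ * (1 - θ)) / 2)

def beta₂ (q θ : ℝ) : ℝ :=
  ((1 - q) ^ 3 + q ^ 3) * (θ ^ 2 / 2) + q * (1 - q) * ((1 - θ ^ 2) / 2)

/-- The explicit value of the error exponent with crossover probability `q`. -/
def noisyExponent (q θ : ℝ) : ℝ :=
  -Real.log (1 - 4 * ((beta₁ q θ + beta₂ q θ) / 2 - √(beta₁ q θ * beta₂ q θ)))

end

/-! The error event is squeezed between one crossing of two weights and finitely many. Let `{u,v}`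
be an edge of `T` and let `{i,k}` join the two sides of this edge. If `{i,k}` is strictly heavier,
exchanging the two improves `T`, so the estimate is wrong (`IsMWST.weight_le`). Conversely, an
optimal tree other than `T` always exhibits such a pair that is at least as heavy as `{u,v}`
(`IsMWST.exists_crossing`). Tie-breaking only matters between `<` and `≤`, which does not affect the
exponent.

The difference of two weights, times `n`, is a random walk with steps in `{-1,0,1}`. If `a` and `b`
are the probabilities of a step up and down, the reference walk crosses with probability of order
`(1 - (√b - √a)²)^n` up to polynomial factors: a Chernoff bound gives the upper estimate
(`IsIIDSample.measureReal_crossing_le`), and the coefficients of powers of a quadratic polynomial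
give the lower one (`IsIIDSample.measureReal_crossing_ge`).

It remains to find the most likely crossing. In terms of `±1` spins and `ρ = 1 - 2θ`, a tree model
is `2^(-p) ∏ (1 + ρ s_u s_v)` over the edges, and its moments follow from the symmetry that flips
all spins on one side of an edge. The channel multiplies a product of `m` distinct spins by `(1 -
2q)^m`. Hence `a` and `b` are governed by `κ = E[s_i s_k s_u s_v]`, where `κ ≤ ρ`, and even `κ ≤ ρ²`
if the four nodes are distinct. The extreme case is a two-edge path `u = i`, `v`, `k`: there `κ =
ρ`, `a = 2β₂`, `b = 2β₁`. It occurs because `p > 2`, and `crossing_chernoff_le` bounds all other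
crossings by it.

For maximum likelihood, every tree carries a model, and the log-likelihood of the model on a tree is
an increasing affine function of the agreement weight of the tree (`IsTreeModel.sum_log`). The
estimate is thus a maximum weight spanning tree for `q = 0`. -/

/-! ### Cutting a tree at an edge -/

section Tree

variable {V : Type*} {T : SimpleGraph V} {u v i k : V}

/-- The vertices that can be reached from `u` without using the edge `{u,v}`. -/
def edgeSide (T : SimpleGraph V) (u v : V) : Set V :=
  {w | (T.deleteEdges {s(u, v)}).Reachable u w}

theorem left_mem_edgeSide : u ∈ edgeSide T u v := SimpleGraph.Reachable.refl _

theorem right_notMem_edgeSide (hT : T.IsAcyclic) (h : T.Adj u v) : v ∉ edgeSide T u v :=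
  SimpleGraph.isAcyclic_iff_forall_adj_isBridge.1 hT h

theorem mem_edgeSide_iff_of_adj {x y : V} (h : T.Adj x y) (hne : s(x, y) ≠ s(u, v)) :
    x ∈ edgeSide T u v ↔ y ∈ edgeSide T u v := by
  have hadj : (T.deleteEdges {s(u, v)}).Adj x y := by
    rw [SimpleGraph.deleteEdges_adj]
    exact ⟨h, by simpa using hne⟩
  exact ⟨fun hx => hx.trans hadj.reachable, fun hy => hy.trans hadj.symm.reachable⟩

/-- Along a walk from `u` the current vertex stays connected to `u` or to `v`: a step through the
deleted edge itself lands on one of its ends. -/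
theorem mem_edgeSide_symm_of_notMem (hT : T.Connected) {w : V} (hw : w ∉ edgeSide T u v) :
    w ∈ edgeSide T v u := by
  have key : ∀ x y, T.Walk x y → x ∈ edgeSide T u v ∪ edgeSide T v u →
      y ∈ edgeSide T u v ∪ edgeSide T v u := by
    intro x y p
    induction p with
    | nil => exact id
    | @cons x y z h p ih =>
      intro hx
      apply ih
      by_cases hne : s(x, y) = s(u, v)
      · rcases Sym2.eq_iff.1 hne with ⟨rfl, rfl⟩ | ⟨rfl, rfl⟩
        · exact Or.inr left_mem_edgeSide
        · exact Or.inl left_mem_edgeSide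
      · refine hx.imp (mem_edgeSide_iff_of_adj h hne).1
          (mem_edgeSide_iff_of_adj h (by rwa [Sym2.eq_swap (a := v)])).1
  obtain ⟨p⟩ := hT.preconnected u w
  exact (key u w p (Or.inl left_mem_edgeSide)).resolve_left hw

theorem SimpleGraph.Walk.exists_getVert_mem_notMem {a b : V} (p : T.Walk a b) {U : Set V}
    (ha : a ∈ U) (hb : b ∉ U) :
    ∃ j < p.length, p.getVert j ∈ U ∧ p.getVert (j + 1) ∉ U := by
  by_contra! hcon
  have key : ∀ j ≤ p.length, p.getVert j ∈ U := by
    intro j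
    induction j with
    | zero => intro _; simpa using ha
    | succ j ih => intro hj; exact hcon j (by omega) (ih (by omega))
  exact hb (by simpa using key p.length le_rfl)

theorem SimpleGraph.Walk.IsPath.getVert_edge_ne {a b : V} {p : T.Walk a b} (hp : p.IsPath)
    {j l : ℕ} (hj : j < p.length) (hl : l < p.length) (hne : l ≠ j) :
    s(p.getVert l, p.getVert (l + 1)) ≠ s(p.getVert j, p.getVert (j + 1)) := by
  intro h
  have inj := hp.getVert_injOn
  rcases Sym2.eq_iff.1 h with ⟨h1, -⟩ | ⟨h1, h2⟩
  · exact hne (inj (by simp; omega) (by simp; omega) h1)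
  · have := inj (by simp; omega) (by simp; omega) h1
    have := inj (by simp; omega) (by simp; omega) h2
    omega

/-- A path uses each edge once, so the side can change only at step `j`, and there it does change
because every edge of an acyclic graph is a bridge. -/
theorem SimpleGraph.Walk.IsPath.getVert_mem_edgeSide_iff (hT : T.IsAcyclic) {a b : V}
    {p : T.Walk a b} (hp : p.IsPath) {j : ℕ} (hj : j < p.length) {l : ℕ} (hl : l ≤ p.length) :
    p.getVert l ∈ edgeSide T (p.getVert j) (p.getVert (j + 1)) ↔ l ≤ j := by
  have step : ∀ m < p.length, m ≠ j →
      (p.getVert m ∈ edgeSide T (p.getVert j) (p.getVert (j + 1)) ↔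
        p.getVert (m + 1) ∈ edgeSide T (p.getVert j) (p.getVert (j + 1))) := fun m hm hne =>
    mem_edgeSide_iff_of_adj (p.adj_getVert_succ hm) (hp.getVert_edge_ne hj hm hne)
  have up : ∀ m, j + 1 + m ≤ p.length →
      p.getVert (j + 1 + m) ∉ edgeSide T (p.getVert j) (p.getVert (j + 1)) := by
    intro m
    induction m with
    | zero => intro _; exact right_notMem_edgeSide hT (p.adj_getVert_succ hj)
    | succ m ih => intro hm h; exact ih (by omega) ((step (j + 1 + m) (by omega) (by omega)).2 h)
  have down : ∀ m ≤ j, p.getVert (j - m) ∈ edgeSide T (p.getVert j) (p.getVert (j + 1)) := by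
    intro m
    induction m with
    | zero => intro _; exact left_mem_edgeSide
    | succ m ih =>
      intro hm
      refine (step (j - (m + 1)) (by omega) (by omega)).2 ?_
      rw [show j - (m + 1) + 1 = j - m by omega]
      exact ih (by omega)
  constructor
  · intro h
    by_contra hlt
    refine up (l - (j + 1)) (by omega) ?_
    rwa [show j + 1 + (l - (j + 1)) = l by omega]
  · intro h
    have := down (j - l) (by omega)
    rwa [show j - (j - l) = l by omega] at this

/-- A path between the two sides of an edge of a tree traverses this edge. -/
theorem exists_isPath_through_edge (hT : T.IsTree) (hadj : T.Adj u v)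
    (hi : i ∈ edgeSide T u v) (hk : k ∉ edgeSide T u v) :
    ∃ p : T.Walk i k, p.IsPath ∧ ∃ j < p.length, p.getVert j = u ∧ p.getVert (j + 1) = v := by
  obtain ⟨p, hp⟩ := hT.connected.exists_isPath i k
  obtain ⟨j, hj, h1, h2⟩ := p.exists_getVert_mem_notMem hi hk
  refine ⟨p, hp, j, hj, ?_⟩
  by_cases hne : s(p.getVert j, p.getVert (j + 1)) = s(u, v)
  · rcases Sym2.eq_iff.1 hne with h | ⟨h3, -⟩
    · exact h
    · exact absurd (h3 ▸ h1) (right_notMem_edgeSide hT.isAcyclic hadj)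
  · exact absurd ((mem_edgeSide_iff_of_adj (p.adj_getVert_succ hj) hne).1 h1) h2

/-- Replacing an edge of a tree by a pair that joins the two sides of the edge gives a tree. -/
theorem SimpleGraph.IsTree.exchange (hT : T.IsTree)
    (hi : i ∈ edgeSide T u v) (hk : k ∉ edgeSide T u v) :
    (T.deleteEdges {s(u, v)} ⊔ SimpleGraph.edge i k).IsTree := by
  have hik : i ≠ k := by rintro rfl; exact hk hi
  constructor
  · have hne := hT.connected.nonempty
    have hiu : (T.deleteEdges {s(u, v)} ⊔ SimpleGraph.edge i k).Reachable u i :=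
      hi.mono le_sup_left
    have hadj : (T.deleteEdges {s(u, v)} ⊔ SimpleGraph.edge i k).Adj i k := by
      simp [SimpleGraph.edge_adj, hik]
    have hall : ∀ w, (T.deleteEdges {s(u, v)} ⊔ SimpleGraph.edge i k).Reachable u w := by
      intro w
      by_cases hw : w ∈ edgeSide T u v
      · exact hw.mono le_sup_left
      · have hw' : (T.deleteEdges {s(u, v)}).Reachable v w := by
          have := mem_edgeSide_symm_of_notMem hT.connected hw
          rwa [edgeSide, Sym2.eq_swap] at this
        have hk' : (T.deleteEdges {s(u, v)}).Reachable v k := by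
          have := mem_edgeSide_symm_of_notMem hT.connected hk
          rwa [edgeSide, Sym2.eq_swap] at this
        exact hiu.trans (hadj.reachable.trans ((hk'.symm.trans hw').mono le_sup_left))
    exact ⟨fun x y => (hall x).symm.trans (hall y)⟩
  · refine SimpleGraph.IsAcyclic.sup_edge_of_not_reachable ?_
      (hT.isAcyclic.anti (SimpleGraph.deleteEdges_le _))
    exact fun h => hk (hi.trans h)

/-- Otherwise no path has two edges, so the graph is complete, and then three distinct vertices give
such a path. It supplies the crossing for the lower bound. -/
theorem SimpleGraph.Connected.exists_two_adj (hT : T.Connected) {a b c : V}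
    (hab : a ≠ b) (hac : a ≠ c) (hbc : b ≠ c) :
    ∃ i j k, T.Adj i j ∧ T.Adj j k ∧ i ≠ k := by
  by_contra! hcon
  have adj : ∀ x y, x ≠ y → T.Adj x y := by
    intro x y hxy
    obtain ⟨p, hp⟩ := hT.exists_isPath x y
    rcases Nat.lt_or_ge p.length 2 with h | h
    · have h0 : p.length ≠ 0 := fun h0 => hxy (SimpleGraph.Walk.eq_of_length_eq_zero h0)
      exact SimpleGraph.Walk.adj_of_length_eq_one (p := p) (by omega)
    · have := hp.getVert_injOn (by simp) (by simpa using h)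
        (hcon _ _ _ (p.adj_getVert_succ (i := 0) (by omega))
          (p.adj_getVert_succ (i := 1) (by omega)))
      omega
  exact hbc (hcon b a c (adj _ _ hab.symm) (adj _ _ hac))

end Tree

/-! ### Exchange inequalities for maximum weight spanning trees -/

section Weight

variable {p : ℕ} {w : Sym2 (Fin p) → ℝ} {T G : SimpleGraph (Fin p)} {u v i k : Fin p}

theorem graphWeight_exchange (hadj : T.Adj u v)
    (hi : i ∈ edgeSide T u v) (hk : k ∉ edgeSide T u v) :
    graphWeight w (T.deleteEdges {s(u, v)} ⊔ SimpleGraph.edge i k) + w s(u, v) =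
      graphWeight w T + w s(i, k) := by
  classical
  have hik : i ≠ k := by rintro rfl; exact hk hi
  have h1 : (T.deleteEdges {s(u, v)} ⊔ SimpleGraph.edge i k).edgeFinset =
      insert s(i, k) (T.edgeFinset.erase s(u, v)) := by
    ext e
    simp only [SimpleGraph.mem_edgeFinset, SimpleGraph.edgeSet_sup, SimpleGraph.edgeSet_deleteEdges,
      SimpleGraph.edgeSet_edge_of_ne hik, Finset.mem_insert, Finset.mem_erase, Set.mem_union,
      Set.mem_sdiff, Set.mem_singleton_iff]
    tauto
  have h2 : s(i, k) ∉ T.edgeFinset.erase s(u, v) := by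
    simp only [SimpleGraph.mem_edgeFinset, Finset.mem_erase, SimpleGraph.mem_edgeSet, not_and]
    intro hne hadj'
    exact hk ((mem_edgeSide_iff_of_adj hadj' hne).1 hi)
  have h3 := Finset.add_sum_erase T.edgeFinset w (a := s(u, v)) (by simpa using hadj)
  have h4 : graphWeight w (T.deleteEdges {s(u, v)} ⊔ SimpleGraph.edge i k) =
      w s(i, k) + ∑ e ∈ T.edgeFinset.erase s(u, v), w e := by
    rw [← Finset.sum_insert h2, ← h1, graphWeight]
    congr!
  have h5 : graphWeight w T = ∑ e ∈ T.edgeFinset, w e := by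
    rw [graphWeight]
  rw [h4, h5]
  linarith

theorem IsMWST.weight_le (h : IsMWST w T) (hadj : T.Adj u v)
    (hi : i ∈ edgeSide T u v) (hk : k ∉ edgeSide T u v) : w s(i, k) ≤ w s(u, v) := by
  have h1 := graphWeight_exchange (w := w) hadj hi hk
  have h2 := h.2 _ (h.1.exchange hi hk)
  linarith

/-- Take an edge `{u,v}` of `T` missing from `G`. The path of `G` from `u` to `v` leaves the side of
`u` in `T` through an edge `{i,k}` of `G`. Deleting `{i,k}` from `G` separates `u` from `v`, so
optimality of `G` under this exchange gives the inequality. -/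
theorem IsMWST.exists_crossing (h : IsMWST w G) (hT : T.IsTree) (hne : G ≠ T) :
    ∃ u v i k, T.Adj u v ∧ i ∈ edgeSide T u v ∧ k ∉ edgeSide T u v ∧ s(i, k) ≠ s(u, v) ∧
      w s(u, v) ≤ w s(i, k) := by
  have hle : ¬ T ≤ G := fun hle =>
    hne (((SimpleGraph.isTree_iff_minimal_connected.1 h.1).eq_of_le hT.connected hle).symm)
  obtain ⟨u, v, hadj, hG⟩ : ∃ u v, T.Adj u v ∧ ¬ G.Adj u v := by
    by_contra! hcon
    exact hle hcon
  obtain ⟨q, hq⟩ := h.1.connected.exists_isPath u v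
  obtain ⟨j, hj, h1, h2⟩ := q.exists_getVert_mem_notMem (U := edgeSide T u v)
    left_mem_edgeSide (right_notMem_edgeSide hT.isAcyclic hadj)
  have hqadj := q.adj_getVert_succ hj
  refine ⟨u, v, _, _, hadj, h1, h2, ?_, ?_⟩
  · intro heq
    exact hG ((SimpleGraph.mem_edgeSet G).1 (heq ▸ (SimpleGraph.mem_edgeSet G).2 hqadj))
  · refine h.weight_le hqadj ?_ ?_
    · have := (hq.getVert_mem_edgeSide_iff h.1.isAcyclic hj (l := 0) (by omega)).2 (by omega)
      simpa using this
    · have := (hq.getVert_mem_edgeSide_iff h.1.isAcyclic hj (l := q.length) le_rfl).not.2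
        (by omega)
      simpa using this

end Weight

/-! ### Spin moments of Ising models on forests -/

/-- The spin `(-1)^a` of a bit `a`. -/
noncomputable def spin (a : Fin 2) : ℝ := if a = 0 then 1 else -1

theorem spin_mul_self (a : Fin 2) : spin a * spin a = 1 := by
  fin_cases a <;> simp [spin]

theorem abs_spin (a : Fin 2) : |spin a| = 1 := by
  fin_cases a <;> simp [spin]

theorem spin_add_one (a : Fin 2) : spin (a + 1) = -spin a := by
  fin_cases a <;> simp [spin]

section Forest

variable {V : Type*}

/-- The product of the spins at the two ends of an unordered pair. -/
noncomputable def edgeSpin (x : V → Fin 2) : Sym2 V → ℝ :=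
  Sym2.lift ⟨fun i j => spin (x i) * spin (x j), fun _ _ => mul_comm _ _⟩

@[simp] theorem edgeSpin_mk (x : V → Fin 2) (i j : V) :
    edgeSpin x s(i, j) = spin (x i) * spin (x j) := rfl

theorem abs_edgeSpin (x : V → Fin 2) (e : Sym2 V) : |edgeSpin x e| = 1 := by
  induction e with
  | h i j => simp [abs_mul, abs_spin]

open Classical in
/-- Flip the bits in `U`. -/
noncomputable def flipOn (U : Set V) (x : V → Fin 2) (i : V) : Fin 2 :=
  if i ∈ U then x i + 1 else x i

theorem flipOn_involutive (U : Set V) : Function.Involutive (flipOn U) := by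
  intro x
  funext i
  by_cases hi : i ∈ U
  · simp [flipOn, hi, add_assoc, show (1 : Fin 2) + 1 = 0 from rfl]
  · simp [flipOn, hi]

theorem spin_flipOn_of_mem {U : Set V} {i : V} (hi : i ∈ U) (x : V → Fin 2) :
    spin (flipOn U x i) = -spin (x i) := by
  simp [flipOn, hi, spin_add_one]

theorem spin_flipOn_of_notMem {U : Set V} {i : V} (hi : i ∉ U) (x : V → Fin 2) :
    spin (flipOn U x i) = spin (x i) := by
  simp [flipOn, hi]

theorem edgeSpin_flipOn {U : Set V} {i j : V} (h : i ∈ U ↔ j ∈ U) (x : V → Fin 2) :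
    edgeSpin (flipOn U x) s(i, j) = edgeSpin x s(i, j) := by
  by_cases hi : i ∈ U
  · simp [spin_flipOn_of_mem hi, spin_flipOn_of_mem (h.1 hi)]
  · simp [spin_flipOn_of_notMem hi, spin_flipOn_of_notMem (h.not.1 hi)]

theorem one_add_mul_edgeSpin_nonneg {ρ : ℝ} (hρ₀ : 0 ≤ ρ) (hρ₁ : ρ ≤ 1) (x : V → Fin 2) (e : Sym2 V) :
    0 ≤ 1 + ρ * edgeSpin x e := by
  have := (abs_le.1 (abs_edgeSpin x e).le).1
  nlinarith

theorem abs_spin_quad_le (x : V → Fin 2) (a b c d : V) :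
    |spin (x a) * spin (x b) * (spin (x c) * spin (x d))| ≤ 1 := by
  simp [abs_mul, abs_spin]

theorem mem_edgeSide_iff_of_mem_erase [DecidableEq V] {F : Finset (Sym2 V)} {T : SimpleGraph V} {u v : V}
     (hF : ∀ e ∈ F, e ∈ T.edgeSet) (i j : V)
    (h : s(i, j) ∈ F.erase s(u, v)) : i ∈ edgeSide T u v ↔ j ∈ edgeSide T u v := by
  rw [Finset.mem_erase] at h
  exact mem_edgeSide_iff_of_adj (hF _ h.2) h.1

variable [Fintype V] [DecidableEq V]

/-- The expectation of `φ` under the Ising model with correlation `ρ` along the edges in `F`. -/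
noncomputable def isingExp (ρ : ℝ) (F : Finset (Sym2 V)) (φ : (V → Fin 2) → ℝ) : ℝ :=
  (1 / 2) ^ Fintype.card V * ∑ x, φ x * ∏ e ∈ F, (1 + ρ * edgeSpin x e)

variable {ρ : ℝ} {F : Finset (Sym2 V)} {φ : (V → Fin 2) → ℝ} {T : SimpleGraph V}

/-- The flip is a bijection that preserves the weight, since each edge in `F` has both ends flipped
or neither. -/
theorem isingExp_eq_zero {U : Set V} (hF : ∀ i j, s(i, j) ∈ F → (i ∈ U ↔ j ∈ U))
    (hφ : ∀ x, φ (flipOn U x) = -φ x) : isingExp ρ F φ = 0 := by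
  have h : ∑ x, φ x * ∏ e ∈ F, (1 + ρ * edgeSpin x e) =
      ∑ x, -(φ x * ∏ e ∈ F, (1 + ρ * edgeSpin x e)) := by
    rw [← Equiv.sum_comp (flipOn_involutive U).toPerm]
    refine Finset.sum_congr rfl fun x _ => ?_
    rw [Function.Involutive.coe_toPerm, hφ, neg_mul]
    congr 2
    refine Finset.prod_congr rfl fun e he => ?_
    induction e with
    | h i j => rw [edgeSpin_flipOn (hF i j he)]
  rw [Finset.sum_neg_distrib] at h
  rw [isingExp, show ∑ x, φ x * ∏ e ∈ F, (1 + ρ * edgeSpin x e) = 0 by linarith, mul_zero]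

theorem isingExp_erase {e : Sym2 V} (he : e ∈ F) :
    isingExp ρ F φ = isingExp ρ (F.erase e) φ +
      ρ * isingExp ρ (F.erase e) (fun x => φ x * edgeSpin x e) := by
  simp only [isingExp]
  rw [mul_left_comm ρ, ← mul_add, Finset.mul_sum (a := ρ), ← Finset.sum_add_distrib]
  congr 1
  refine Finset.sum_congr rfl fun x _ => ?_
  rw [← Finset.mul_prod_erase F _ he]
  ring

theorem isingExp_erase_eq_zero {u v : V} (hF : ∀ e ∈ F, e ∈ T.edgeSet)
    (hφ : ∀ x, φ (flipOn (edgeSide T u v) x) = -φ x) : isingExp ρ (F.erase s(u, v)) φ = 0 :=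
  isingExp_eq_zero (mem_edgeSide_iff_of_mem_erase hF) hφ

/-- Expand the factor `1 + ρ s_u s_v`. The remaining weight is invariant under flipping the side of
`u`, which kills the constant term if `φ` is odd and the term with `ρ` if `φ` is even, because `s_u
s_v` is itself odd. -/
theorem isingExp_of_odd {u v : V} (hF : ∀ e ∈ F, e ∈ T.edgeSet) (he : s(u, v) ∈ F)
    (hφ : ∀ x, φ (flipOn (edgeSide T u v) x) = -φ x) :
    isingExp ρ F φ =
      ρ * isingExp ρ (F.erase s(u, v)) (fun x => φ x * (spin (x u) * spin (x v))) := by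
  rw [isingExp_erase he, isingExp_erase_eq_zero hF hφ, zero_add]
  rfl

theorem isingExp_of_even {u v : V} (hT : T.IsAcyclic) (hF : ∀ e ∈ F, e ∈ T.edgeSet)
    (he : s(u, v) ∈ F) (hφ : ∀ x, φ (flipOn (edgeSide T u v) x) = φ x) :
    isingExp ρ F φ = isingExp ρ (F.erase s(u, v)) φ := by
  rw [isingExp_erase he, isingExp_erase_eq_zero (T := T)
    (φ := fun x => φ x * edgeSpin x s(u, v)) hF, mul_zero, add_zero]
  intro x
  rw [hφ, edgeSpin_mk, edgeSpin_mk, spin_flipOn_of_mem left_mem_edgeSide,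
    spin_flipOn_of_notMem (right_notMem_edgeSide hT (hF _ he))]
  ring

theorem isingExp_one (hT : T.IsAcyclic) (hF : ∀ e ∈ F, e ∈ T.edgeSet) :
    isingExp ρ F (fun _ => 1) = 1 := by
  induction F using Finset.induction_on with
  | empty => simp [isingExp]
  | insert e F he ih =>
    induction e with
    | h u v =>
      rw [isingExp_of_even hT hF (Finset.mem_insert_self _ _) (fun _ => rfl),
        Finset.erase_insert he]
      exact ih fun e he => hF e (Finset.mem_insert_of_mem he)

theorem isingExp_le_one (hρ₀ : 0 ≤ ρ) (hρ₁ : ρ ≤ 1) (hT : T.IsAcyclic)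
    (hF : ∀ e ∈ F, e ∈ T.edgeSet) (hφ : ∀ x, |φ x| ≤ 1) : isingExp ρ F φ ≤ 1 := by
  rw [← isingExp_one (ρ := ρ) hT hF, isingExp, isingExp]
  gcongr with x
  · exact Finset.prod_nonneg fun e _ => one_add_mul_edgeSpin_nonneg hρ₀ hρ₁ x e
  · exact (le_abs_self _).trans (hφ x)

theorem isingExp_edge (hT : T.IsAcyclic) (hF : ∀ e, e ∈ F ↔ e ∈ T.edgeSet) {u v : V}
    (hadj : T.Adj u v) : isingExp ρ F (fun x => spin (x u) * spin (x v)) = ρ := by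
  rw [isingExp_of_odd (fun e => (hF e).1) ((hF _).2 hadj)]
  · simp only [mul_mul_mul_comm, spin_mul_self, mul_one]
    rw [isingExp_one hT, mul_one]
    exact fun e he => (hF e).1 (Finset.mem_of_mem_erase he)
  · intro x
    rw [spin_flipOn_of_mem left_mem_edgeSide,
      spin_flipOn_of_notMem (right_notMem_edgeSide hT hadj), neg_mul]

/-- The product `s_i s_k` is odd under the flip, so the edge contributes `ρ s_u s_v`; the resulting
fourfold product is even, so the erased edge can be put back for free. -/
theorem isingExp_pair (hT : T.IsAcyclic) (hF : ∀ e, e ∈ F ↔ e ∈ T.edgeSet) {u v i k : V}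
    (hadj : T.Adj u v) (hi : i ∈ edgeSide T u v) (hk : k ∉ edgeSide T u v) :
    isingExp ρ F (fun x => spin (x i) * spin (x k)) =
      ρ * isingExp ρ F (fun x => spin (x i) * spin (x k) * (spin (x u) * spin (x v))) := by
  have hF' : ∀ e ∈ F, e ∈ T.edgeSet := fun e => (hF e).1
  rw [isingExp_of_odd hF' ((hF _).2 hadj), isingExp_of_even hT hF' ((hF _).2 hadj)]
  · intro x
    rw [spin_flipOn_of_mem left_mem_edgeSide, spin_flipOn_of_mem hi, spin_flipOn_of_notMem hk,
      spin_flipOn_of_notMem (right_notMem_edgeSide hT hadj)]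
    ring
  · intro x
    rw [spin_flipOn_of_mem hi, spin_flipOn_of_notMem hk, neg_mul]

variable {u v i k : V}

/-- The path from `i` to `k` runs through `{u,v}` and has another edge. The fourfold product is odd
under the cut at the last or the first edge of the path, which extracts a factor `ρ`. -/
theorem isingExp_quad_le (hρ₀ : 0 ≤ ρ) (hρ₁ : ρ ≤ 1) (hT : T.IsTree)
    (hF : ∀ e, e ∈ F ↔ e ∈ T.edgeSet) (hadj : T.Adj u v)
    (hi : i ∈ edgeSide T u v) (hk : k ∉ edgeSide T u v) (hne : s(i, k) ≠ s(u, v)) :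
    isingExp ρ F (fun x => spin (x i) * spin (x k) * (spin (x u) * spin (x v))) ≤ ρ := by
  have hF' : ∀ e ∈ F, e ∈ T.edgeSet := fun e => (hF e).1
  obtain ⟨p, hp, j, hj, hu, hv⟩ := exists_isPath_through_edge hT hadj hi hk
  have side := fun (m l : ℕ) (hm : m < p.length) (hl : l ≤ p.length) =>
    hp.getVert_mem_edgeSide_iff hT.isAcyclic hm hl
  have finish : ∀ m < p.length, (∀ x : V → Fin 2,
      (fun x : V → Fin 2 => spin (x i) * spin (x k) * (spin (x u) * spin (x v)))
        (flipOn (edgeSide T (p.getVert m) (p.getVert (m + 1))) x) =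
      -(fun x : V → Fin 2 => spin (x i) * spin (x k) * (spin (x u) * spin (x v))) x) →
      isingExp ρ F (fun x => spin (x i) * spin (x k) * (spin (x u) * spin (x v))) ≤ ρ := by
    intro m hm hodd
    rw [isingExp_of_odd hF' ((hF _).2 (p.adj_getVert_succ hm)) hodd]
    refine mul_le_of_le_one_right hρ₀ (isingExp_le_one hρ₀ hρ₁ hT.isAcyclic
      (fun e he => hF' e (Finset.mem_of_mem_erase he)) fun x => ?_)
    rw [abs_mul, abs_mul (spin _) (spin _), abs_spin, abs_spin, mul_one, mul_one]
    exact abs_spin_quad_le x _ _ _ _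
  -- If `{u,v}` is not the last edge of the path, cutting the last edge leaves `i`, `u`, `v` on one
  -- side; otherwise it is not the first, and cutting the first edge isolates `i` from the other
  -- three.
  rcases Nat.lt_or_ge (j + 1) p.length with hjl | hjl
  · have h0 := (side (p.length - 1) 0 (by omega) (by omega)).2 (by omega)
    have h1 := (side (p.length - 1) j (by omega) (by omega)).2 (by omega)
    have h2 := (side (p.length - 1) (j + 1) (by omega) (by omega)).2 (by omega)
    have h3 := (side (p.length - 1) p.length (by omega) (by omega)).not.2 (by omega)
    simp only [hu, hv, SimpleGraph.Walk.getVert_zero, SimpleGraph.Walk.getVert_length]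
      at h0 h1 h2 h3
    refine finish (p.length - 1) (by omega) fun x => ?_
    simp only
    rw [spin_flipOn_of_mem h0, spin_flipOn_of_mem h1, spin_flipOn_of_mem h2,
      spin_flipOn_of_notMem h3]
    ring
  · have hjl' : j + 1 = p.length := by omega
    have hvk : v = k := by rw [← hv, hjl', SimpleGraph.Walk.getVert_length]
    have hj0 : j ≠ 0 := by
      rintro rfl
      rw [SimpleGraph.Walk.getVert_zero] at hu
      exact hne (by rw [hu, hvk])
    have h0 := (side 0 0 (by omega) (by omega)).2 (by omega)
    have h1 := (side 0 j (by omega) (by omega)).not.2 (by omega)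
    have h2 := (side 0 (j + 1) (by omega) (by omega)).not.2 (by omega)
    have h3 := (side 0 p.length (by omega) (by omega)).not.2 (by omega)
    rw [hu] at h1
    rw [hv] at h2
    rw [SimpleGraph.Walk.getVert_length] at h3
    have h0' : i ∈ edgeSide T (p.getVert 0) (p.getVert (0 + 1)) := by simpa using h0
    refine finish 0 (by omega) fun x => ?_
    simp only
    rw [spin_flipOn_of_mem h0', spin_flipOn_of_notMem h1, spin_flipOn_of_notMem h2,
      spin_flipOn_of_notMem h3]
    ring

/-- Now both the first and the last edge of the path differ from `{u,v}`, and each extracts a factor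
`ρ`. -/
theorem isingExp_quad_le_sq (hρ₀ : 0 ≤ ρ) (hρ₁ : ρ ≤ 1) (hT : T.IsTree)
    (hF : ∀ e, e ∈ F ↔ e ∈ T.edgeSet) (hadj : T.Adj u v)
    (hi : i ∈ edgeSide T u v) (hk : k ∉ edgeSide T u v) (hiu : i ≠ u) (hkv : k ≠ v) :
    isingExp ρ F (fun x => spin (x i) * spin (x k) * (spin (x u) * spin (x v))) ≤ ρ ^ 2 := by
  have hF' : ∀ e ∈ F, e ∈ T.edgeSet := fun e => (hF e).1
  obtain ⟨p, hp, j, hj, hu, hv⟩ := exists_isPath_through_edge hT hadj hi hk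
  have side := fun (m l : ℕ) (hm : m < p.length) (hl : l ≤ p.length) =>
    hp.getVert_mem_edgeSide_iff hT.isAcyclic hm hl
  have hj0 : j ≠ 0 := by
    rintro rfl
    rw [SimpleGraph.Walk.getVert_zero] at hu
    exact hiu hu
  have hjl : j + 1 ≠ p.length := by
    intro h
    rw [h, SimpleGraph.Walk.getVert_length] at hv
    exact hkv hv
  rw [isingExp_of_odd (T := T) hF' ((hF _).2 (p.adj_getVert_succ (i := 0) (by omega))),
    isingExp_of_odd (T := T) (u := p.getVert (p.length - 1)) (v := p.getVert (p.length - 1 + 1))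
      (fun e he => hF' e (Finset.mem_of_mem_erase he)), ← mul_assoc, ← pow_two]
  · refine mul_le_of_le_one_right (sq_nonneg ρ) (isingExp_le_one hρ₀ hρ₁ hT.isAcyclic
      (fun e he => hF' e (Finset.mem_of_mem_erase (Finset.mem_of_mem_erase he))) fun x => ?_)
    simp [abs_mul, abs_spin]
  · rw [Finset.mem_erase]
    exact ⟨hp.getVert_edge_ne (by omega) (by omega) (by omega),
      (hF _).2 (p.adj_getVert_succ (by omega))⟩
  · intro x
    have h0 := (side (p.length - 1) 0 (by omega) (by omega)).2 (by omega)
    have h4 := (side (p.length - 1) 1 (by omega) (by omega)).2 (by omega)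
    have h1 := (side (p.length - 1) j (by omega) (by omega)).2 (by omega)
    have h2 := (side (p.length - 1) (j + 1) (by omega) (by omega)).2 (by omega)
    have h3 := (side (p.length - 1) p.length (by omega) (by omega)).not.2 (by omega)
    simp only [hu, hv, SimpleGraph.Walk.getVert_zero, SimpleGraph.Walk.getVert_length]
      at h0 h1 h2 h3
    simp only [zero_add, SimpleGraph.Walk.getVert_zero]
    rw [spin_flipOn_of_mem h0, spin_flipOn_of_mem h1, spin_flipOn_of_mem h2,
      spin_flipOn_of_mem h4, spin_flipOn_of_notMem h3]
    ring
  · intro x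
    have h0 := (side 0 0 (by omega) (by omega)).2 (by omega)
    have h1 := (side 0 j (by omega) (by omega)).not.2 (by omega)
    have h2 := (side 0 (j + 1) (by omega) (by omega)).not.2 (by omega)
    have h3 := (side 0 p.length (by omega) (by omega)).not.2 (by omega)
    rw [hu] at h1
    rw [hv] at h2
    rw [SimpleGraph.Walk.getVert_length] at h3
    have h0' : i ∈ edgeSide T (p.getVert 0) (p.getVert (0 + 1)) := by simpa using h0
    rw [spin_flipOn_of_mem h0', spin_flipOn_of_notMem h1, spin_flipOn_of_notMem h2,
      spin_flipOn_of_notMem h3]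
    ring

end Forest

/-! ### Tree models, the channel and the law of one step -/

section Model

variable {p : ℕ}

theorem nodeMarginal_eq_sum_pairMarginal (Q : (Fin p → Fin 2) → ℝ) (i j : Fin p) (a : Fin 2) :
    nodeMarginal Q i a = pairMarginal Q i j a 0 + pairMarginal Q i j a 1 := by
  simp only [nodeMarginal, pairMarginal, Finset.sum_filter, ← Finset.sum_add_distrib]
  refine Finset.sum_congr rfl fun x _ => ?_
  generalize x i = c
  generalize x j = d
  revert a c d
  simp [Fin.forall_fin_two]

/-- Uniform node marginals force `(1 - θ)/2` on the diagonal, so the factor is `2(1 - θ)` on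
agreement and `2θ` otherwise. -/
theorem edgeFactor_of_marginals {Q : (Fin p → Fin 2) → ℝ} {θ : ℝ} {i j : Fin p}
    (hunif : ∀ i a, nodeMarginal Q i a = 1 / 2)
    (hpair : pairMarginal Q i j 0 1 = θ / 2 ∧ pairMarginal Q i j 1 0 = θ / 2)
    (x : Fin p → Fin 2) :
    edgeFactor Q x s(i, j) = 1 + (1 - 2 * θ) * edgeSpin x s(i, j) := by
  have h0 := nodeMarginal_eq_sum_pairMarginal Q i j 0
  have h1 := nodeMarginal_eq_sum_pairMarginal Q i j 1
  rw [hunif, hpair.1] at h0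
  rw [hunif, hpair.2] at h1
  have h00 : pairMarginal Q i j 0 0 = (1 - θ) / 2 := by linarith
  have h11 : pairMarginal Q i j 1 1 = (1 - θ) / 2 := by linarith
  change pairMarginal Q i j (x i) (x j) / (nodeMarginal Q i (x i) * nodeMarginal Q j (x j)) =
    1 + (1 - 2 * θ) * (spin (x i) * spin (x j))
  rw [hunif, hunif]
  generalize x i = c
  generalize x j = d
  revert c d
  simp only [Fin.forall_fin_two, spin, h00, h11, hpair.1, hpair.2]
  norm_num
  constructor <;> ring_nf <;> simp

variable {θ : ℝ} {T : SimpleGraph (Fin p)} {P : (Fin p → Fin 2) → ℝ}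

theorem IsTreeModel.apply_eq (hP : IsTreeModel θ T P) {F : Finset (Sym2 (Fin p))}
    (hF : ∀ e, e ∈ F ↔ e ∈ T.edgeSet) (x : Fin p → Fin 2) :
    P x = (1 / 2) ^ p * ∏ e ∈ F, (1 + (1 - 2 * θ) * edgeSpin x e) := by
  rw [hP.factorizes x]
  congr 1
  · simp [hP.uniform]
  · refine Finset.prod_congr (by ext e; simp [hF]) fun e he => ?_
    rw [hF] at he
    induction e with
    | h i j => exact edgeFactor_of_marginals hP.uniform (hP.homogeneous i j he) x

theorem IsTreeModel.sum_mul (hP : IsTreeModel θ T P) {F : Finset (Sym2 (Fin p))}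
    (hF : ∀ e, e ∈ F ↔ e ∈ T.edgeSet) (φ : (Fin p → Fin 2) → ℝ) :
    ∑ x, φ x * P x = isingExp (1 - 2 * θ) F φ := by
  rw [isingExp, Finset.mul_sum, Fintype.card_fin]
  refine Finset.sum_congr rfl fun x _ => ?_
  rw [hP.apply_eq hF]
  ring

/-- The channel kernel in product form, so that sums over outputs factor over the coordinates. -/
theorem pow_hammingDist_mul_pow (q : ℝ) (x y : Fin p → Fin 2) :
    q ^ hammingDist x y * (1 - q) ^ (p - hammingDist x y) =
      ∏ i, if x i = y i then 1 - q else q := by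
  have h : p - hammingDist x y = (Finset.univ.filter fun i => x i = y i).card := by
    have := Finset.card_filter_add_card_filter_not (s := (Finset.univ : Finset (Fin p)))
      (fun i => x i = y i)
    rw [Finset.card_univ, Fintype.card_fin] at this
    rw [hammingDist]
    simp only [ne_eq]
    omega
  rw [h, Finset.prod_ite, Finset.prod_const, Finset.prod_const, mul_comm]
  rfl

/-- A binary symmetric channel with crossover probability `q` damps products of spins. -/
theorem sum_spin_mul_bscOutput (q : ℝ) (P : (Fin p → Fin 2) → ℝ) (S : Finset (Fin p)) :
    ∑ y, (∏ i ∈ S, spin (y i)) * bscOutput q P y =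
      (1 - 2 * q) ^ S.card * ∑ x, (∏ i ∈ S, spin (x i)) * P x := by
  have key : ∀ x : Fin p → Fin 2, ∑ y : Fin p → Fin 2,
      (∏ i ∈ S, spin (y i)) * ∏ i, (if x i = y i then 1 - q else q) =
      (1 - 2 * q) ^ S.card * ∏ i ∈ S, spin (x i) := by
    intro x
    have h1 : ∀ y : Fin p → Fin 2,
        (∏ i ∈ S, spin (y i)) * ∏ i, (if x i = y i then 1 - q else q) =
        ∏ i, ((if i ∈ S then spin (y i) else 1) * if x i = y i then 1 - q else q) := by
      intro y
      rw [Finset.prod_mul_distrib]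
      simp [Finset.prod_ite_mem]
    simp_rw [h1]
    rw [← Fintype.piFinset_univ, ← Finset.prod_univ_sum (fun _ => Finset.univ)
      (fun i b => (if i ∈ S then spin b else 1) * if x i = b then 1 - q else q)]
    have h2 : ∀ i, ∑ b : Fin 2, ((if i ∈ S then spin b else 1) * if x i = b then 1 - q else q) =
        if i ∈ S then (1 - 2 * q) * spin (x i) else 1 := by
      intro i
      rw [Fin.sum_univ_two]
      generalize x i = c
      revert c
      by_cases hi : i ∈ S
      · simp only [hi, if_true, spin, Fin.forall_fin_two]
        norm_num
        constructor <;> ring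
      · simp [hi, Fin.forall_fin_two]
    simp_rw [h2]
    rw [Finset.prod_ite_mem, Finset.univ_inter, Finset.prod_mul_distrib, Finset.prod_const]
  simp only [bscOutput, Finset.mul_sum]
  rw [Finset.sum_comm]
  refine Finset.sum_congr rfl fun x _ => ?_
  rw [← mul_assoc, ← key x, Finset.sum_mul]
  refine Finset.sum_congr rfl fun y _ => ?_
  rw [pow_hammingDist_mul_pow]
  ring

theorem bscOutput_zero (P : (Fin p → Fin 2) → ℝ) : bscOutput 0 P = P := by
  funext y
  rw [bscOutput, Finset.sum_eq_single y]
  · simp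
  · intro x _ hx
    rw [zero_pow (by simpa using hx)]
    ring
  · simp

/-- How much more the pair `{i,k}` agrees in `y` than the pair `{u,v}`. -/
def crossStep (u v i k : Fin p) (y : Fin p → Fin 2) : ℤ :=
  (if y i = y k then 1 else 0) - (if y u = y v then 1 else 0)

/-- The event is "`i`, `k` agree and `u`, `v` disagree", with indicator `(1 + s_i s_k)(1 - s_u
s_v)/4`. -/
theorem sum_crossStep_eq_one (u v i k : Fin p) (D : (Fin p → Fin 2) → ℝ) :
    ∑ y with crossStep u v i k y = 1, D y =
      (∑ y, D y - ∑ y, spin (y u) * spin (y v) * D y + ∑ y, spin (y i) * spin (y k) * D y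
        - ∑ y, spin (y i) * spin (y k) * (spin (y u) * spin (y v)) * D y) / 4 := by
  rw [Finset.sum_filter, ← Finset.sum_sub_distrib, ← Finset.sum_add_distrib,
    ← Finset.sum_sub_distrib, Finset.sum_div]
  refine Finset.sum_congr rfl fun y _ => ?_
  have key : ∀ (c₁ c₂ c₃ c₄ : Fin 2) (d : ℝ),
      (if ((if c₁ = c₂ then 1 else 0) - if c₃ = c₄ then 1 else 0 : ℤ) = 1 then d else 0) =
        (d - spin c₃ * spin c₄ * d + spin c₁ * spin c₂ * d
          - spin c₁ * spin c₂ * (spin c₃ * spin c₄) * d) / 4 := by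
    simp only [Fin.forall_fin_two, spin]
    norm_num
    ring_nf
    simp
  exact key _ _ _ _ _

theorem sum_crossStep_eq_neg_one (u v i k : Fin p) (D : (Fin p → Fin 2) → ℝ) :
    ∑ y with crossStep u v i k y = -1, D y =
      (∑ y, D y + ∑ y, spin (y u) * spin (y v) * D y - ∑ y, spin (y i) * spin (y k) * D y
        - ∑ y, spin (y i) * spin (y k) * (spin (y u) * spin (y v)) * D y) / 4 := by
  have h : ∀ y, crossStep u v i k y = -1 ↔ crossStep i k u v y = 1 := by
    intro y
    simp only [crossStep]
    omega
  simp_rw [h, sum_crossStep_eq_one]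
  rw [show ∑ y, spin (y u) * spin (y v) * (spin (y i) * spin (y k)) * D y =
    ∑ y, spin (y i) * spin (y k) * (spin (y u) * spin (y v)) * D y from
    Finset.sum_congr rfl fun y _ => by ring]
  ring

theorem sum_bscOutput (q : ℝ) (hP : IsTreeModel θ T P) : ∑ y, bscOutput q P y = 1 := by
  have := sum_spin_mul_bscOutput q P ∅
  simpa [hP.mem_stdSimplex.2] using this

theorem sum_spin_pair_mul_bscOutput (q : ℝ) (P : (Fin p → Fin 2) → ℝ) {i k : Fin p}
    (hik : i ≠ k) : ∑ y, spin (y i) * spin (y k) * bscOutput q P y =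
      (1 - 2 * q) ^ 2 * ∑ x, spin (x i) * spin (x k) * P x := by
  have := sum_spin_mul_bscOutput q P {i, k}
  simpa [Finset.prod_pair hik, Finset.card_pair hik] using this

theorem sum_spin_quad_mul_bscOutput (q : ℝ) (P : (Fin p → Fin 2) → ℝ) {i k u v : Fin p}
    (hik : i ≠ k) (huv : u ≠ v) (hiu : i ≠ u) (hiv : i ≠ v) (hku : k ≠ u) (hkv : k ≠ v) :
    ∑ y, spin (y i) * spin (y k) * (spin (y u) * spin (y v)) * bscOutput q P y =
      (1 - 2 * q) ^ 4 * ∑ x, spin (x i) * spin (x k) * (spin (x u) * spin (x v)) * P x := by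
  have h := sum_spin_mul_bscOutput q P {i, k, u, v}
  have hc : ({i, k, u, v} : Finset (Fin p)).card = 4 := by
    rw [Finset.card_insert_of_notMem (by simp [*]), Finset.card_insert_of_notMem (by simp [*]),
      Finset.card_pair huv]
  have hp : ∀ y : Fin p → Fin 2, ∏ j ∈ ({i, k, u, v} : Finset (Fin p)), spin (y j) =
      spin (y i) * spin (y k) * (spin (y u) * spin (y v)) := by
    intro y
    rw [Finset.prod_insert (by simp [*]), Finset.prod_insert (by simp [*]),
      Finset.prod_pair huv]
    ring
  simpa [hc, hp] using h

/-- The moments that determine the law of `crossStep` when `{i,k}` joins the two sides of the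
edge `{u,v}`. -/
theorem exists_crossStep_moments (hθ₀ : 0 < θ) (hθ₁ : θ < 1 / 2) (hP : IsTreeModel θ T P) (q : ℝ)
    {u v i k : Fin p} (hadj : T.Adj u v) (hi : i ∈ edgeSide T u v) (hk : k ∉ edgeSide T u v)
    (hne : s(i, k) ≠ s(u, v)) :
    ∃ κ C : ℝ, κ ≤ 1 - 2 * θ ∧
      (C = (1 - 2 * q) ^ 2 * κ ∨ C = (1 - 2 * q) ^ 4 * κ ∧ κ ≤ (1 - 2 * θ) ^ 2) ∧
      ∑ y with crossStep u v i k y = 1, bscOutput q P y =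
        (1 - (1 - 2 * q) ^ 2 * (1 - 2 * θ) + (1 - 2 * q) ^ 2 * ((1 - 2 * θ) * κ) - C) / 4 ∧
      ∑ y with crossStep u v i k y = -1, bscOutput q P y =
        (1 + (1 - 2 * q) ^ 2 * (1 - 2 * θ) - (1 - 2 * q) ^ 2 * ((1 - 2 * θ) * κ) - C) / 4 := by
  classical
  have hF : ∀ e, e ∈ T.edgeFinset ↔ e ∈ T.edgeSet := fun e => SimpleGraph.mem_edgeFinset
  have hT := hP.isTree
  have huv : u ≠ v := hadj.ne
  have hik : i ≠ k := by rintro rfl; exact hk hi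
  have hv := right_notMem_edgeSide hT.isAcyclic hadj
  have hiv : i ≠ v := by rintro rfl; exact hv hi
  have hku : k ≠ u := by rintro rfl; exact hk left_mem_edgeSide
  refine ⟨isingExp (1 - 2 * θ) T.edgeFinset
    (fun x => spin (x i) * spin (x k) * (spin (x u) * spin (x v))),
    ∑ y, spin (y i) * spin (y k) * (spin (y u) * spin (y v)) * bscOutput q P y, ?_, ?_, ?_, ?_⟩
  · exact isingExp_quad_le (by linarith) (by linarith) hT hF hadj hi hk hne
  · rw [← hP.sum_mul hF]
    -- If the pairs share a node, its spin squares to one and only two spins remain, with damping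
    -- `(1 - 2q)²`; four distinct nodes give `(1 - 2q)⁴`, together with the sharper bound on `κ`.
    by_cases hiu : i = u
    · left
      subst hiu
      have hkv : v ≠ k := by rintro rfl; exact hne rfl
      have h : ∀ y : Fin p → Fin 2, spin (y i) * spin (y k) * (spin (y i) * spin (y v)) =
          spin (y v) * spin (y k) := fun y => by
        linear_combination spin (y v) * spin (y k) * spin_mul_self (y i)
      simp only [h]
      exact sum_spin_pair_mul_bscOutput q P hkv
    by_cases hkv : k = v
    · left
      subst hkv
      have h : ∀ y : Fin p → Fin 2, spin (y i) * spin (y k) * (spin (y u) * spin (y k)) =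
          spin (y i) * spin (y u) := fun y => by
        linear_combination spin (y i) * spin (y u) * spin_mul_self (y k)
      simp only [h]
      exact sum_spin_pair_mul_bscOutput q P hiu
    · right
      refine ⟨sum_spin_quad_mul_bscOutput q P hik huv hiu hiv hku hkv, ?_⟩
      rw [hP.sum_mul hF]
      exact isingExp_quad_le_sq (by linarith) (by linarith) hT hF hadj hi hk hiu hkv
  · rw [sum_crossStep_eq_one, sum_bscOutput q hP, sum_spin_pair_mul_bscOutput q P huv,
      sum_spin_pair_mul_bscOutput q P hik, hP.sum_mul hF, hP.sum_mul hF,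
      isingExp_edge hT.isAcyclic hF hadj, isingExp_pair hT.isAcyclic hF hadj hi hk]
  · rw [sum_crossStep_eq_neg_one, sum_bscOutput q hP, sum_spin_pair_mul_bscOutput q P huv,
      sum_spin_pair_mul_bscOutput q P hik, hP.sum_mul hF, hP.sum_mul hF,
      isingExp_edge hT.isAcyclic hF hadj, isingExp_pair hT.isAcyclic hF hadj hi hk]

/-- The shared node collapses the fourfold product to the edge product `s_j s_k`, of mean `ρ` before
the channel. This is where `beta₁` and `beta₂` come from. -/
theorem crossStep_moments_two_adj (hP : IsTreeModel θ T P) (q : ℝ) {i j k : Fin p}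
    (hij : T.Adj i j) (hjk : T.Adj j k) (hik : i ≠ k) :
    k ∉ edgeSide T i j ∧
      ∑ y with crossStep i j i k y = 1, bscOutput q P y = 2 * beta₂ q θ ∧
      ∑ y with crossStep i j i k y = -1, bscOutput q P y = 2 * beta₁ q θ := by
  classical
  have hF : ∀ e, e ∈ T.edgeFinset ↔ e ∈ T.edgeSet := fun e => SimpleGraph.mem_edgeFinset
  have hT := hP.isTree.isAcyclic
  have hne : s(j, k) ≠ s(i, j) := by
    rw [Ne, Sym2.eq_iff]
    rintro (⟨h, -⟩ | ⟨-, h⟩)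
    · exact hij.ne h.symm
    · exact hik h.symm
  have hk : k ∉ edgeSide T i j := fun h =>
    right_notMem_edgeSide hT hij ((mem_edgeSide_iff_of_adj hjk hne).2 h)
  have h : ∀ y : Fin p → Fin 2, spin (y i) * spin (y k) * (spin (y i) * spin (y j)) =
      spin (y j) * spin (y k) := fun y => by
    linear_combination spin (y j) * spin (y k) * spin_mul_self (y i)
  refine ⟨hk, ?_, ?_⟩
  · rw [sum_crossStep_eq_one]
    simp only [h]
    rw [sum_bscOutput q hP, sum_spin_pair_mul_bscOutput q P hij.ne,
      sum_spin_pair_mul_bscOutput q P hik, sum_spin_pair_mul_bscOutput q P hjk.ne,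
      hP.sum_mul hF, hP.sum_mul hF, hP.sum_mul hF, isingExp_edge hT hF hij,
      isingExp_pair hT hF hij left_mem_edgeSide hk]
    simp only [h]
    rw [isingExp_edge hT hF hjk, beta₂]
    ring
  · rw [sum_crossStep_eq_neg_one]
    simp only [h]
    rw [sum_bscOutput q hP, sum_spin_pair_mul_bscOutput q P hij.ne,
      sum_spin_pair_mul_bscOutput q P hik, sum_spin_pair_mul_bscOutput q P hjk.ne,
      hP.sum_mul hF, hP.sum_mul hF, hP.sum_mul hF, isingExp_edge hT hF hij,
      isingExp_pair hT hF hij left_mem_edgeSide hk]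
    simp only [h]
    rw [isingExp_edge hT hF hjk, beta₁]
    ring

end Model

/-! ### Lower bounds for coefficients of powers of a quadratic -/

section StepPolynomial

open Polynomial

/-- The generating polynomial of a step that takes the values `0`, `1`, `2` with weights
`b`, `c`, `a`. -/
noncomputable def stepPoly (a b c : ℝ) : ℝ[X] := C a * X ^ 2 + C c * X + C b

variable {a b c : ℝ}

theorem natDegree_stepPoly_le (a b c : ℝ) : (stepPoly a b c).natDegree ≤ 2 :=
  natDegree_quadratic_le

theorem natDegree_stepPoly_pow_le (a b c : ℝ) (n : ℕ) :
    ((stepPoly a b c) ^ n).natDegree ≤ 2 * n :=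
  natDegree_pow_le.trans (by have := natDegree_stepPoly_le a b c; nlinarith)

theorem coeff_stepPoly (a b c : ℝ) (j : ℕ) : (stepPoly a b c).coeff j =
    if j = 0 then b else if j = 1 then c else if j = 2 then a else 0 := by
  rcases j with _ | _ | _ | j <;> simp [stepPoly, coeff_X, coeff_C]

theorem reflect_stepPoly_pow (t c : ℝ) (n : ℕ) :
    reflect (2 * n) ((stepPoly t t c) ^ n) = (stepPoly t t c) ^ n := by
  induction n with
  | zero => simp
  | succ n ih =>
    rw [pow_succ, mul_add, mul_one,
      reflect_mul _ _ (natDegree_stepPoly_pow_le t t c n) (natDegree_stepPoly_le t t c), ih]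
    congr 1
    simp only [stepPoly, reflect_add, reflect_C_mul, reflect_C]
    have h : reflect 2 (X : ℝ[X]) = X := by
      simpa [revAt_le] using reflect_monomial (R := ℝ) 2 1
    rw [h, reflect_monomial, revAt_le le_rfl]
    simp
    ring

/-- The power `g = f^m` is palindromic, so the central coefficient of `g²` is the sum of the squares
of the `2m + 1` coefficients of `g`; apply Cauchy–Schwarz with `g(1) = (c + 2t)^m`. -/
theorem central_coeff_symm_ge (t c : ℝ) (m : ℕ) :
    (c + 2 * t) ^ (2 * m) / (2 * m + 1) ≤ ((stepPoly t t c) ^ (2 * m)).coeff (2 * m) := by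
  set g := (stepPoly t t c) ^ m with hg
  have hsymm : ∀ j ≤ 2 * m, g.coeff (2 * m - j) = g.coeff j := by
    intro j hj
    conv_rhs => rw [hg, ← reflect_stepPoly_pow, coeff_reflect, revAt_le hj, ← hg]
  have h1 : ((stepPoly t t c) ^ (2 * m)).coeff (2 * m) =
      ∑ j ∈ Finset.range (2 * m + 1), g.coeff j ^ 2 := by
    rw [two_mul m, pow_add, ← hg, coeff_mul, Finset.Nat.sum_antidiagonal_eq_sum_range_succ_mk]
    refine Finset.sum_congr (by simp) fun j hj => ?_
    rw [Finset.mem_range] at hj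
    simp only
    rw [← two_mul, hsymm j (by omega), pow_two]
  have h2 : (c + 2 * t) ^ m = ∑ j ∈ Finset.range (2 * m + 1), g.coeff j := by
    have h : eval 1 g = (c + 2 * t) ^ m := by
      rw [hg, eval_pow]
      simp [stepPoly]
      ring
    rw [← h, eval_eq_sum_range' (n := 2 * m + 1)
      (Nat.lt_succ_of_le (natDegree_stepPoly_pow_le t t c m))]
    simp only [one_pow, mul_one, hg]
  have h3 := sq_sum_le_card_mul_sum_sq (s := Finset.range (2 * m + 1)) (f := fun j => g.coeff j)
  rw [← h1, ← h2, Finset.card_range, ← pow_mul, mul_comm m 2] at h3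
  rw [div_le_iff₀ (by positivity)]
  push_cast at h3
  linarith

/-- Exponential tilting: substituting `√(b/a) X` for `X` makes the polynomial symmetric up to a
factor `√(b/a)`, and this factor cancels in the central coefficient. -/
theorem central_coeff_ge (ha : 0 < a) (hb : 0 < b) (m : ℕ) :
    (c + 2 * √(a * b)) ^ (2 * m) / (2 * m + 1) ≤
      ((stepPoly a b c) ^ (2 * m)).coeff (2 * m) := by
  have hr : 0 < √(b / a) := Real.sqrt_pos.2 (by positivity)
  have har : a * √(b / a) = √(a * b) := by
    rw [← Real.sqrt_sq ha.le, ← Real.sqrt_mul (sq_nonneg a), Real.sqrt_sq ha.le]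
    congr 1
    field_simp
  have hbr : √(a * b) * √(b / a) = b := by
    rw [← har, mul_assoc, Real.mul_self_sqrt (by positivity)]
    field_simp
  have hcomp : (stepPoly a b c).comp (C √(b / a) * X) =
      C √(b / a) * stepPoly √(a * b) √(a * b) c := by
    have h1 : C a * C √(b / a) = C √(a * b) := by rw [← C_mul, har]
    have h2 : C √(b / a) * C √(a * b) = C b := by rw [← C_mul, mul_comm, hbr]
    simp only [stepPoly, add_comp, mul_comp, pow_comp, X_comp, C_comp]
    linear_combination C √(b / a) * X ^ 2 * h1 - h2
  have hpow : ((stepPoly a b c) ^ (2 * m)).comp (C √(b / a) * X) =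
      C (√(b / a) ^ (2 * m)) * (stepPoly √(a * b) √(a * b) c) ^ (2 * m) := by
    rw [pow_comp, hcomp, mul_pow, C_pow]
  have hcoeff := congrArg (fun f => f.coeff (2 * m)) hpow
  simp only [comp_C_mul_X_coeff, coeff_C_mul] at hcoeff
  rw [mul_comm] at hcoeff
  rw [mul_left_cancel₀ (pow_pos hr _).ne' hcoeff]
  exact central_coeff_symm_ge _ _ _

theorem coeff_stepPoly_pow_nonneg (ha : 0 ≤ a) (hb : 0 ≤ b) (hc : 0 ≤ c) (n j : ℕ) :
    0 ≤ ((stepPoly a b c) ^ n).coeff j := by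
  induction n generalizing j with
  | zero =>
    rw [pow_zero, coeff_one]
    split_ifs <;> norm_num
  | succ n ih =>
    rw [pow_succ, coeff_mul]
    refine Finset.sum_nonneg fun x _ => mul_nonneg (ih _) ?_
    rw [coeff_stepPoly]
    split_ifs <;> first | assumption | exact le_rfl

/-- Keep only the walks whose last step goes up. -/
theorem coeff_stepPoly_pow_succ_ge (ha : 0 ≤ a) (hb : 0 ≤ b) (hc : 0 ≤ c) (n j : ℕ) :
    ((stepPoly a b c) ^ n).coeff j * a ≤ ((stepPoly a b c) ^ (n + 1)).coeff (j + 2) := by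
  rw [pow_succ, coeff_mul]
  refine le_trans (le_of_eq ?_) (Finset.single_le_sum (f := fun x : ℕ × ℕ =>
    ((stepPoly a b c) ^ n).coeff x.1 * (stepPoly a b c).coeff x.2) (fun x _ => ?_)
    (Finset.HasAntidiagonal.mem_antidiagonal.2 (rfl : (j, 2).1 + (j, 2).2 = j + 2)))
  · simp [coeff_stepPoly]
  · have := coeff_stepPoly_pow_nonneg ha hb hc 1 x.2
    rw [pow_one] at this
    exact mul_nonneg (coeff_stepPoly_pow_nonneg ha hb hc n x.1) this

/-- Some coefficient above the middle one is large. -/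
theorem exists_coeff_stepPoly_pow_ge (ha : 0 < a) (hb : 0 < b) (hc : 0 ≤ c) (ha1 : a ≤ 1)
    (hG : c + 2 * √(a * b) ≤ 1) {n : ℕ} (hn : n ≠ 0) :
    ∃ j, n < j ∧ a ^ 2 * (c + 2 * √(a * b)) ^ n / (n + 1) ≤ ((stepPoly a b c) ^ n).coeff j := by
  have hG0 : 0 ≤ c + 2 * √(a * b) := by positivity
  have key : ∀ m, 2 * m ≤ n → (c + 2 * √(a * b)) ^ n / (n + 1) ≤
      ((stepPoly a b c) ^ (2 * m)).coeff (2 * m) := by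
    intro m hm
    refine le_trans ?_ (central_coeff_ge ha hb m)
    have : ((2 * m : ℕ) : ℝ) ≤ n := by exact_mod_cast hm
    push_cast at this
    have h1 := pow_le_pow_of_le_one hG0 hG hm
    gcongr
  -- The walk returns to its centre after `2m` steps, and the remaining one or two steps go up, so
  -- that it ends strictly above. This costs at most the factor `a²`.
  obtain ⟨m, hm | hm⟩ : ∃ m, n = 2 * m + 1 ∨ n = 2 * m + 2 := ⟨(n - 1) / 2, by omega⟩
  · refine ⟨2 * m + 2, by omega, ?_⟩
    have h1 := key m (by omega)
    have h2 := coeff_stepPoly_pow_succ_ge ha.le hb.le hc (2 * m) (2 * m)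
    rw [← hm] at h2
    refine le_trans ?_ h2
    rw [mul_div_assoc, mul_comm]
    have h3 : a ^ 2 ≤ a := by nlinarith
    exact mul_le_mul h1 h3 (sq_nonneg a) (coeff_stepPoly_pow_nonneg ha.le hb.le hc _ _)
  · refine ⟨2 * m + 2 + 2, by omega, ?_⟩
    have h1 := key m (by omega)
    have h2 := coeff_stepPoly_pow_succ_ge ha.le hb.le hc (2 * m) (2 * m)
    have h3 := coeff_stepPoly_pow_succ_ge ha.le hb.le hc (2 * m + 1) (2 * m + 2)
    subst hm
    refine le_trans ?_ h3
    rw [mul_div_assoc, mul_comm, pow_two, ← mul_assoc]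
    gcongr
    exact le_trans (by gcongr) h2

end StepPolynomial

/-! ### Laws of sums of independent steps and crossing probabilities -/

section SumLaw

open Polynomial

variable {Ω : Type*} [MeasurableSpace Ω] {μ : Measure Ω} [IsProbabilityMeasure μ]

/-- The law of a sum of independent variables with values in `ℕ` and generating polynomial `f`
has generating polynomial `f ^ n`. -/
theorem measureReal_sum_eq_coeff_pow {Z : ℕ → Ω → ℕ} (hmeas : ∀ k, Measurable (Z k))
    (hindep : iIndepFun Z μ) {f : ℝ[X]} (hlaw : ∀ k j, μ.real {ω | Z k ω = j} = f.coeff j)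
    (n j : ℕ) : μ.real {ω | ∑ k ∈ Finset.range n, Z k ω = j} = (f ^ n).coeff j := by
  induction n generalizing j with
  | zero =>
    rw [pow_zero, coeff_one]
    by_cases hj : j = 0
    · simp [hj]
    · simp [hj, Ne.symm hj]
  | succ n ih =>
    have hS : Measurable fun ω => ∑ k ∈ Finset.range n, Z k ω :=
      Finset.measurable_fun_sum _ fun k _ => hmeas k
    have hset : {ω | ∑ k ∈ Finset.range (n + 1), Z k ω = j} =
        ⋃ x ∈ Finset.HasAntidiagonal.antidiagonal j,
          ({ω | ∑ k ∈ Finset.range n, Z k ω = x.1} ∩ {ω | Z n ω = x.2}) := by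
      ext ω
      simp only [Finset.sum_range_succ, Set.mem_ofPred_eq, Set.mem_iUnion, Finset.HasAntidiagonal.mem_antidiagonal,
        Set.mem_inter_iff, exists_prop, Prod.exists]
      constructor
      · intro h
        exact ⟨_, _, h, rfl, rfl⟩
      · rintro ⟨x, y, h, rfl, rfl⟩
        exact h
    have hind := hindep.indepFun_sum_range_succ hmeas n
    rw [hset, measureReal_biUnion_finset, pow_succ, coeff_mul]
    · refine Finset.sum_congr rfl fun x _ => ?_
      rw [← ih, ← hlaw n]
      have := hind.measure_inter_preimage_eq_mul {x.1} {x.2}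
        (measurableSet_singleton _) (measurableSet_singleton _)
      have h2 := congrArg ENNReal.toReal this
      rw [ENNReal.toReal_mul] at h2
      have e1 : {ω | ∑ k ∈ Finset.range n, Z k ω = x.1} =
          (∑ k ∈ Finset.range n, Z k) ⁻¹' {x.1} := by
        ext ω
        simp [Finset.sum_apply]
      have e2 : {ω | Z n ω = x.2} = Z n ⁻¹' {x.2} := by
        ext ω
        simp
      rw [e1, e2]
      exact h2
    · rintro x - y - hxy
      rw [Function.onFun, Set.disjoint_left]
      rintro ω ⟨h1, h2⟩ ⟨h3, h4⟩
      exact hxy (Prod.ext (h1.symm.trans h3) (h2.symm.trans h4))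
    · intro x _
      exact (hS (measurableSet_singleton x.1)).inter (hmeas n (measurableSet_singleton x.2))

end SumLaw

section Sample

open Polynomial

variable {p : ℕ} {Ω : Type*} [MeasurableSpace Ω] {μ : Measure Ω} [IsProbabilityMeasure μ]
  {D : (Fin p → Fin 2) → ℝ} {Y : ℕ → Ω → Fin p → Fin 2}

theorem IsIIDSample.measureReal_setOf (hY : IsIIDSample μ D Y) (k : ℕ)
    (A : (Fin p → Fin 2) → Prop) [DecidablePred A] :
    μ.real {ω | A (Y k ω)} = ∑ y with A y, D y := by
  have hset : {ω | A (Y k ω)} = ⋃ y ∈ Finset.univ.filter A, {ω | Y k ω = y} := by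
    ext ω
    simp
  rw [hset, measureReal_biUnion_finset]
  · exact Finset.sum_congr rfl fun y _ => hY.law k y
  · rintro x - y - hxy
    rw [Function.onFun, Set.disjoint_left]
    rintro ω h1 h2
    exact hxy (h1.symm.trans h2)
  · intro y _
    exact hY.measurable k (measurableSet_singleton y)

theorem IsIIDSample.sum_eq_one (hY : IsIIDSample μ D Y) : ∑ y, D y = 1 := by
  have := hY.measureReal_setOf 0 (fun _ => True)
  simpa using this.symm

theorem crossStep_mem (u v i k : Fin p) (y : Fin p → Fin 2) :
    crossStep u v i k y = -1 ∨ crossStep u v i k y = 0 ∨ crossStep u v i k y = 1 := by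
  simp only [crossStep]
  split_ifs <;> simp

/-- The steps of the crossing walk, shifted to be natural numbers. -/
def shiftedStep (u v i k : Fin p) (y : Fin p → Fin 2) : ℕ := (crossStep u v i k y + 1).toNat

theorem shiftedStep_cast (u v i k : Fin p) (y : Fin p → Fin 2) :
    (shiftedStep u v i k y : ℤ) = crossStep u v i k y + 1 := by
  have := crossStep_mem u v i k y
  rw [shiftedStep]
  omega

variable {u v i k : Fin p} {a b : ℝ}

theorem IsIIDSample.measureReal_shiftedStep (hY : IsIIDSample μ D Y)
    (ha : ∑ y with crossStep u v i k y = 1, D y = a)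
    (hb : ∑ y with crossStep u v i k y = -1, D y = b) (n j : ℕ) :
    μ.real {ω | shiftedStep u v i k (Y n ω) = j} = (stepPoly a b (1 - a - b)).coeff j := by
  have hstep := fun y => shiftedStep_cast u v i k y
  have hmem := fun y => crossStep_mem u v i k y
  rw [hY.measureReal_setOf n (fun y => shiftedStep u v i k y = j), coeff_stepPoly]
  have h0 : (∑ y with shiftedStep u v i k y = 0, D y) = b := by
    rw [← hb]
    congr 1
    ext y
    simp only [Finset.mem_filter, Finset.mem_univ, true_and]
    have := hstep y
    omega
  have h2 : (∑ y with shiftedStep u v i k y = 2, D y) = a := by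
    rw [← ha]
    congr 1
    ext y
    simp only [Finset.mem_filter, Finset.mem_univ, true_and]
    have := hstep y
    omega
  split_ifs with h h' h''
  · rw [h, h0]
  · subst h'
    rw [← hY.sum_eq_one, ← h0, ← h2]
    simp only [Finset.sum_filter, ← Finset.sum_sub_distrib]
    refine Finset.sum_congr rfl fun y _ => ?_
    have h3 : shiftedStep u v i k y = 0 ∨ shiftedStep u v i k y = 1 ∨
        shiftedStep u v i k y = 2 := by
      have := hstep y
      have := hmem y
      omega
    rcases h3 with h3 | h3 | h3 <;> simp [h3]
  · rw [h'', h2]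
  · rw [Finset.filter_false_of_mem, Finset.sum_empty]
    intro y _
    have := hstep y
    have := hmem y
    omega

theorem IsIIDSample.measureReal_sum_shiftedStep (hY : IsIIDSample μ D Y)
    (ha : ∑ y with crossStep u v i k y = 1, D y = a)
    (hb : ∑ y with crossStep u v i k y = -1, D y = b) (n j : ℕ) :
    μ.real {ω | ∑ m ∈ Finset.range n, shiftedStep u v i k (Y m ω) = j} =
      ((stepPoly a b (1 - a - b)) ^ n).coeff j := by
  have hm : Measurable (shiftedStep u v i k) := measurable_of_countable _
  exact measureReal_sum_eq_coeff_pow (Z := fun m ω => shiftedStep u v i k (Y m ω))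
    (fun m => hm.comp (hY.measurable m))
    (hY.indep.comp (fun _ => shiftedStep u v i k) fun _ => hm)
    (fun m j => hY.measureReal_shiftedStep ha hb m j) n j

theorem sum_shiftedStep_cast (y : ℕ → Fin p → Fin 2) (n : ℕ) :
    ((∑ m ∈ Finset.range n, shiftedStep u v i k (y m) : ℕ) : ℤ) =
      ∑ m ∈ Finset.range n, crossStep u v i k (y m) + n := by
  push_cast
  simp [shiftedStep_cast, Finset.sum_add_distrib]

theorem IsIIDSample.measureReal_crossing_ge (hY : IsIIDSample μ D Y)
    (ha : ∑ y with crossStep u v i k y = 1, D y = a)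
    (hb : ∑ y with crossStep u v i k y = -1, D y = b) (ha0 : 0 < a) (hb0 : 0 < b)
    (hab : a + b ≤ 1) {n : ℕ} (hn : n ≠ 0) :
    a ^ 2 * (1 - (√b - √a) ^ 2) ^ n / (n + 1) ≤
      μ.real {ω | 0 < ∑ m ∈ Finset.range n, crossStep u v i k (Y m ω)} := by
  have hG : 1 - (√b - √a) ^ 2 = 1 - a - b + 2 * √(a * b) := by
    rw [sub_sq, Real.sq_sqrt ha0.le, Real.sq_sqrt hb0.le, Real.sqrt_mul ha0.le]
    ring
  rw [hG]
  obtain ⟨j, hj, h⟩ := exists_coeff_stepPoly_pow_ge (c := 1 - a - b) ha0 hb0 (by linarith)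
    (by linarith) (by rw [← hG]; linarith [sq_nonneg (√b - √a)]) hn
  refine h.trans ?_
  rw [← hY.measureReal_sum_shiftedStep ha hb]
  refine measureReal_mono fun ω hω => ?_
  have := sum_shiftedStep_cast (u := u) (v := v) (i := i) (k := k) (fun m => Y m ω) n
  simp only [Set.mem_ofPred_eq] at hω ⊢
  omega

/-- Chernoff bound for the crossing of two weights. -/
theorem IsIIDSample.measureReal_crossing_le (hY : IsIIDSample μ D Y)
    (ha : ∑ y with crossStep u v i k y = 1, D y = a)
    (hb : ∑ y with crossStep u v i k y = -1, D y = b) {r : ℝ} (hr : 1 ≤ r) (n : ℕ) :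
    μ.real {ω | 0 ≤ ∑ m ∈ Finset.range n, crossStep u v i k (Y m ω)} ≤
      (1 - a - b + a * r + b / r) ^ n := by
  set f := stepPoly a b (1 - a - b) with hf
  have hr0 : 0 < r := by linarith
  have hnonneg : ∀ j, 0 ≤ (f ^ n).coeff j := fun j => by
    rw [hf, ← hY.measureReal_sum_shiftedStep ha hb]
    exact measureReal_nonneg
  have hsub : {ω | 0 ≤ ∑ m ∈ Finset.range n, crossStep u v i k (Y m ω)} ⊆
      ⋃ j ∈ (Finset.range (2 * n + 1)).filter (n ≤ ·),
        {ω | ∑ m ∈ Finset.range n, shiftedStep u v i k (Y m ω) = j} := by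
    intro ω hω
    simp only [Set.mem_ofPred_eq] at hω
    have h1 := sum_shiftedStep_cast (u := u) (v := v) (i := i) (k := k) (fun m => Y m ω) n
    have h2 : ∑ m ∈ Finset.range n, shiftedStep u v i k (Y m ω) ≤ n * 2 := by
      have := Finset.sum_le_card_nsmul (Finset.range n) (fun m => shiftedStep u v i k (Y m ω)) 2
        fun m _ => by
          have := shiftedStep_cast u v i k (Y m ω)
          have := crossStep_mem u v i k (Y m ω)
          omega
      simpa using this
    simp only [Set.mem_iUnion, Finset.mem_filter, Finset.mem_range, Set.mem_ofPred_eq, exists_prop]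
    exact ⟨_, ⟨by omega, by omega⟩, rfl⟩
  have heval : eval r f / r = 1 - a - b + a * r + b / r := by
    rw [hf, stepPoly]
    simp
    field_simp
    ring
  calc μ.real {ω | 0 ≤ ∑ m ∈ Finset.range n, crossStep u v i k (Y m ω)}
      ≤ ∑ j ∈ (Finset.range (2 * n + 1)).filter (n ≤ ·), (f ^ n).coeff j := by
        refine (measureReal_mono hsub (measure_ne_top _ _)).trans ((measureReal_biUnion_finset_le _ _).trans ?_)
        exact (Finset.sum_congr rfl fun j _ => hY.measureReal_sum_shiftedStep ha hb n j).le
    -- The weight `r^(j - n)` is at least one for `j ≥ n`, and the added terms are nonnegative.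
    _ ≤ ∑ j ∈ Finset.range (2 * n + 1), (f ^ n).coeff j * r ^ j / r ^ n := by
        rw [Finset.sum_filter]
        refine Finset.sum_le_sum fun j _ => ?_
        split_ifs with h
        · rw [mul_div_assoc]
          refine le_mul_of_one_le_right (hnonneg j) ?_
          rw [one_le_div (by positivity)]
          exact pow_le_pow_right₀ hr h
        · have := hnonneg j
          positivity
    _ = (1 - a - b + a * r + b / r) ^ n := by
        rw [← Finset.sum_div, ← eval_eq_sum_range' (n := 2 * n + 1)
          (Nat.lt_succ_of_le (natDegree_stepPoly_pow_le _ _ _ n)), eval_pow, ← div_pow, heval]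

end Sample

/-! ### Differences of agreement weights as random walks -/

section Weights

variable {p n : ℕ}

theorem pairMarginal_empiricalDist (y : Fin n → Fin p → Fin 2) (i j : Fin p) (a b : Fin 2) :
    pairMarginal (empiricalDist y) i j a b =
      1 / (n : ℝ) * ∑ m, if y m i = a ∧ y m j = b then 1 else 0 := by
  simp only [pairMarginal, empiricalDist]
  rw [← Finset.mul_sum, Finset.sum_comm]
  congr 1
  refine Finset.sum_congr rfl fun m _ => ?_
  rw [Finset.sum_ite_eq]
  simp

theorem agreementWeight_mk (y : Fin n → Fin p → Fin 2) (i j : Fin p) :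
    agreementWeight y s(i, j) = 1 / (n : ℝ) * ∑ m, if y m i = y m j then 1 else 0 := by
  change pairMarginal (empiricalDist y) i j 0 0 + pairMarginal (empiricalDist y) i j 1 1 = _
  rw [pairMarginal_empiricalDist, pairMarginal_empiricalDist, ← mul_add, ← Finset.sum_add_distrib]
  congr 1
  refine Finset.sum_congr rfl fun m _ => ?_
  generalize y m i = c
  generalize y m j = d
  revert c d
  simp [Fin.forall_fin_two]

theorem agreementWeight_sub (y : ℕ → Fin p → Fin 2) (u v i k : Fin p) :
    agreementWeight (fun m : Fin n => y m) s(i, k) - agreementWeight (fun m : Fin n => y m) s(u, v) =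
      1 / (n : ℝ) * ((∑ m ∈ Finset.range n, crossStep u v i k (y m) : ℤ) : ℝ) := by
  rw [agreementWeight_mk, agreementWeight_mk, ← mul_sub, ← Finset.sum_sub_distrib,
    ← Fin.sum_univ_eq_sum_range (fun m => crossStep u v i k (y m))]
  push_cast
  congr 1
  refine Finset.sum_congr rfl fun m _ => ?_
  simp [crossStep]

end Weights

/-! ### From two-sided bounds to the exponential rate -/

theorem tendsto_neg_inv_mul_log {P : ℕ → ℝ} {G K c : ℝ} (hG : 0 < G) (hc : 0 < c)
    (hlow : ∀ n ≠ 0, c * G ^ n / (n + 1) ≤ P n) (hup : ∀ n ≠ 0, P n ≤ K * G ^ n) :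
    Tendsto (fun n : ℕ => -(1 / (n : ℝ)) * Real.log (P n)) atTop (𝓝 (-Real.log G)) := by
  have hinv : Tendsto (fun n : ℕ => 1 / (n : ℝ)) atTop (𝓝 0) := tendsto_one_div_atTop_nhds_zero_nat
  have hlog : Tendsto (fun n : ℕ => 1 / (n : ℝ) * Real.log (n + 1)) atTop (𝓝 0) := by
    have h1 : Tendsto (fun x : ℝ => Real.log x / x) atTop (𝓝 0) := by
      simpa using Real.isLittleO_log_id_atTop.tendsto_div_nhds_zero
    have h2 : Tendsto (fun n : ℕ => Real.log ((n + 1 : ℕ) : ℝ) / ((n + 1 : ℕ) : ℝ))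
        atTop (𝓝 0) :=
      h1.comp (tendsto_natCast_atTop_atTop.comp (tendsto_add_atTop_nat 1))
    have h3 : Tendsto (fun n : ℕ => 1 + 1 / (n : ℝ)) atTop (𝓝 (1 + 0)) := hinv.const_add 1
    have h4 := h2.mul h3
    rw [zero_mul] at h4
    refine h4.congr' ?_
    filter_upwards [eventually_ne_atTop 0] with n hn
    have : (n : ℝ) ≠ 0 := by exact_mod_cast hn
    push_cast
    field_simp
  have hlowlim : Tendsto (fun n : ℕ => -Real.log G - 1 / (n : ℝ) * Real.log K) atTop
      (𝓝 (-Real.log G)) := by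
    simpa using (hinv.mul_const (Real.log K)).const_sub (-Real.log G)
  have huplim : Tendsto (fun n : ℕ => -Real.log G - 1 / (n : ℝ) * Real.log c
      + 1 / (n : ℝ) * Real.log (n + 1)) atTop (𝓝 (-Real.log G)) := by
    simpa using ((hinv.mul_const (Real.log c)).const_sub (-Real.log G)).add hlog
  have hpos : ∀ n ≠ 0, 0 < P n := fun n hn => lt_of_lt_of_le (by positivity) (hlow n hn)
  -- The two bounds at `n = 1` already force this.
  have hK : 0 < K := by
    have := (hpos 1 one_ne_zero).trans_le (hup 1 one_ne_zero)
    rw [pow_one] at this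
    exact pos_of_mul_pos_left this hG.le
  refine tendsto_of_tendsto_of_tendsto_of_le_of_le' hlowlim huplim ?_ ?_
  · filter_upwards [eventually_ne_atTop 0] with n hn
    have hn' : (0 : ℝ) < n := by exact_mod_cast Nat.pos_of_ne_zero hn
    have h := Real.log_le_log (hpos n hn) (hup n hn)
    rw [Real.log_mul hK.ne' (by positivity), Real.log_pow] at h
    have h2 := mul_le_mul_of_nonneg_left h (by positivity : 0 ≤ 1 / (n : ℝ))
    have h3 : 1 / (n : ℝ) * (Real.log K + n * Real.log G) =
        1 / (n : ℝ) * Real.log K + Real.log G := by field_simp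
    linarith
  · filter_upwards [eventually_ne_atTop 0] with n hn
    have hn' : (0 : ℝ) < n := by exact_mod_cast Nat.pos_of_ne_zero hn
    have h := Real.log_le_log (by positivity) (hlow n hn)
    rw [Real.log_div (by positivity) (by positivity), Real.log_mul hc.ne' (by positivity),
      Real.log_pow] at h
    have h2 := mul_le_mul_of_nonneg_left h (by positivity : 0 ≤ 1 / (n : ℝ))
    have h3 : 1 / (n : ℝ) * (Real.log c + n * Real.log G - Real.log (n + 1)) =
        1 / (n : ℝ) * Real.log c + Real.log G - 1 / (n : ℝ) * Real.log (n + 1) := by field_simp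
    linarith

/-! ### The dominant crossing -/

/-- If both weights of a step are controlled by those of a reference step, then so is the
Chernoff bound at the optimal parameter of the reference step. -/
theorem chernoff_bound_le {a b a₀ b₀ r l : ℝ} (ha₀ : 0 < a₀) (hr : 1 ≤ r) (hrb : a₀ * r ^ 2 = b₀)
    (hl : 1 ≤ l) (hdiff : b - a = l * (b₀ - a₀)) (ha : a ≤ l * a₀) :
    1 - a - b + a * r + b / r ≤ 1 - a₀ * (r - 1) ^ 2 := by
  have hr0 : 0 < r := by linarith
  have hb : b = a + l * (b₀ - a₀) := by linarith
  have hg : 0 ≤ r + 1 / r - 2 := by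
    have : r + 1 / r - 2 = (r - 1) ^ 2 / r := by field_simp; ring
    rw [this]
    positivity
  -- For a fixed drift `b - a` the bound increases with `a`. Replacing `a` by `l a₀` turns it into
  -- `1 - l a₀ (r - 1)²`, and `l ≥ 1` finishes.
  have h1 : 1 - a - b + a * r + b / r =
      1 + a * (r + 1 / r - 2) - l * (b₀ - a₀) * (1 - 1 / r) := by
    rw [hb]
    field_simp
    ring
  have h2 : l * a₀ * (r + 1 / r - 2) - l * (b₀ - a₀) * (1 - 1 / r) =
      -(l * (a₀ * (r - 1) ^ 2)) := by
    rw [← hrb]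
    field_simp
    ring
  have h3 : a * (r + 1 / r - 2) ≤ l * a₀ * (r + 1 / r - 2) := by gcongr
  have h4 : a₀ * (r - 1) ^ 2 ≤ l * (a₀ * (r - 1) ^ 2) :=
    le_mul_of_one_le_left (by positivity) hl
  linarith

section Exponent

variable {q θ : ℝ}

theorem two_mul_beta₂_pos (hθ₀ : 0 < θ) (hq₀ : 0 ≤ q) (hq₁ : q < 1 / 2) : 0 < 2 * beta₂ q θ := by
  have h : 2 * beta₂ q θ = (1 - 2 * q) ^ 2 * θ ^ 2 + q * (1 - q) := by rw [beta₂]; ring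
  have h1 : 0 < 1 - 2 * q := by linarith
  have h2 : 0 ≤ q * (1 - q) := mul_nonneg hq₀ (by linarith)
  rw [h]
  positivity

theorem two_mul_beta₂_lt (hθ₀ : 0 < θ) (hθ₁ : θ < 1 / 2) (hq₁ : q < 1 / 2) :
    2 * beta₂ q θ < 2 * beta₁ q θ := by
  have h : 2 * beta₁ q θ - 2 * beta₂ q θ = (1 - 2 * q) ^ 2 * (θ * (1 - 2 * θ)) := by
    rw [beta₁, beta₂]; ring
  have h1 : 0 < 1 - 2 * q := by linarith
  have h2 : 0 < 1 - 2 * θ := by linarith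
  have : 0 < (1 - 2 * q) ^ 2 * (θ * (1 - 2 * θ)) := by positivity
  linarith

theorem two_mul_beta_add_lt (hθ₁ : θ < 1 / 2) (hq₁ : q < 1 / 2) :
    2 * beta₂ q θ + 2 * beta₁ q θ < 1 := by
  have h : 2 * beta₂ q θ + 2 * beta₁ q θ = (1 - (1 - 2 * q) ^ 2 * (1 - 2 * θ)) / 2 := by
    rw [beta₁, beta₂]; ring
  have h1 : 0 < 1 - 2 * q := by linarith
  have h2 : 0 < 1 - 2 * θ := by linarith
  have : 0 < (1 - 2 * q) ^ 2 * (1 - 2 * θ) := by positivity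
  linarith

theorem noisyExponent_eq (h₁ : 0 ≤ beta₁ q θ) (h₂ : 0 ≤ beta₂ q θ) :
    noisyExponent q θ = -Real.log (1 - (√(2 * beta₁ q θ) - √(2 * beta₂ q θ)) ^ 2) := by
  rw [noisyExponent, sub_sq, Real.sq_sqrt (by positivity), Real.sq_sqrt (by positivity),
    Real.sqrt_mul zero_le_two, Real.sqrt_mul zero_le_two, Real.sqrt_mul h₁]
  congr 2
  linear_combination (-2 * √(beta₁ q θ) * √(beta₂ q θ)) * Real.mul_self_sqrt (zero_le_two (α := ℝ))

theorem noisyExponent_zero (hθ₀ : 0 < θ) :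
    noisyExponent 0 θ = -Real.log (1 - θ * (1 - √(4 * θ * (1 - θ)))) := by
  have h1 : beta₁ 0 θ = θ * (1 - θ) / 2 := by rw [beta₁]; ring
  have h2 : beta₂ 0 θ = θ ^ 2 / 2 := by rw [beta₂]; ring
  have h3 : √(beta₁ 0 θ * beta₂ 0 θ) = θ / 4 * √(4 * θ * (1 - θ)) := by
    rw [h1, h2, ← Real.sqrt_sq (by positivity : 0 ≤ θ / 4), ← Real.sqrt_mul (by positivity)]
    congr 1
    ring
  rw [noisyExponent, h3, h1, h2]
  congr 2
  ring

/-- Among all crossings, those of two pairs at distance one and two are the most likely. -/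
theorem crossing_chernoff_le (hθ₀ : 0 < θ) (hθ₁ : θ < 1 / 2) (hq₀ : 0 ≤ q) (hq₁ : q < 1 / 2)
    {κ C a b : ℝ} (hκ : κ ≤ 1 - 2 * θ)
    (hC : C = (1 - 2 * q) ^ 2 * κ ∨ C = (1 - 2 * q) ^ 4 * κ ∧ κ ≤ (1 - 2 * θ) ^ 2)
    (ha : a = (1 - (1 - 2 * q) ^ 2 * (1 - 2 * θ) + (1 - 2 * q) ^ 2 * ((1 - 2 * θ) * κ) - C) / 4)
    (hb : b = (1 + (1 - 2 * q) ^ 2 * (1 - 2 * θ) - (1 - 2 * q) ^ 2 * ((1 - 2 * θ) * κ) - C) / 4) :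
    1 - a - b + a * √(2 * beta₁ q θ / (2 * beta₂ q θ)) +
        b / √(2 * beta₁ q θ / (2 * beta₂ q θ)) ≤
      1 - (√(2 * beta₁ q θ) - √(2 * beta₂ q θ)) ^ 2 := by
  have ha₀ := two_mul_beta₂_pos hθ₀ hq₀ hq₁
  have hab := two_mul_beta₂_lt hθ₀ hθ₁ hq₁
  have ea : 2 * beta₂ q θ =
      (1 - 2 * (1 - 2 * q) ^ 2 * (1 - 2 * θ) + (1 - 2 * q) ^ 2 * (1 - 2 * θ) ^ 2) / 4 := by
    rw [beta₂]; ring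
  have eb : 2 * beta₁ q θ - 2 * beta₂ q θ =
      (1 - 2 * q) ^ 2 * (1 - 2 * θ) * (1 - (1 - 2 * θ)) / 2 := by
    rw [beta₁, beta₂]; ring
  set a₀ := 2 * beta₂ q θ
  set b₀ := 2 * beta₁ q θ
  have hs1 : (1 - 2 * q) ^ 2 ≤ 1 := by nlinarith
  have hs0 : 0 ≤ (1 - 2 * q) ^ 2 := sq_nonneg _
  have hs4 : (1 - 2 * q) ^ 4 = ((1 - 2 * q) ^ 2) ^ 2 := by ring
  rw [hs4] at hC
  generalize (1 - 2 * q) ^ 2 = s at *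
  have hρ0 : 0 < 1 - 2 * θ := by linarith
  have hρ1 : 0 < 1 - (1 - 2 * θ) := by linarith
  generalize 1 - 2 * θ = ρ at *
  have hfin : 1 - (√b₀ - √a₀) ^ 2 = 1 - a₀ * (√(b₀ / a₀) - 1) ^ 2 := by
    have h1 : √b₀ = √a₀ * √(b₀ / a₀) := by
      rw [← Real.sqrt_mul ha₀.le]
      congr 1
      field_simp
    rw [h1]
    linear_combination (-(√(b₀ / a₀) - 1) ^ 2) * Real.sq_sqrt ha₀.le
  rw [hfin]
  -- `l` is the ratio of the two drifts, as `b - a = sρ(1 - κ)/2` and `b₀ - a₀ = sρ(1 - ρ)/2`.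
  refine chernoff_bound_le (b₀ := b₀) (l := (1 - κ) / (1 - ρ)) ha₀ ?_ ?_ ?_ ?_ ?_
  · rw [Real.one_le_sqrt, one_le_div ha₀]
    exact hab.le
  · rw [Real.sq_sqrt (div_nonneg (ha₀.trans hab).le ha₀.le)]
    field_simp
  · rw [one_le_div hρ1]
    linarith
  · rw [eb, ha, hb]
    field_simp
    ring
  · rw [div_mul_eq_mul_div, le_div_iff₀ hρ1, ea, ha]
    rcases hC with rfl | ⟨rfl, hκ2⟩
    -- Here four times the difference of the two sides is exactly `(1 - s)(ρ - κ)`.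
    · have := mul_nonneg (sub_nonneg.2 hs1) (sub_nonneg.2 hκ)
      nlinarith
    -- Here it is `(1 - s)(ρ - κ(1 + s - sρ))`. The bound `κ ≤ ρ` would not suffice; with `κ ≤ ρ²`
    -- the second factor is at least `ρ(1 - ρ)(1 - sρ)`.
    · have h1 : 0 ≤ 1 + s - s * ρ := by nlinarith
      have h2 : κ * (1 + s - s * ρ) ≤ ρ ^ 2 * (1 + s - s * ρ) := by gcongr
      have h3 : 0 ≤ ρ * ((1 - ρ) * (1 - s * ρ)) := by
        have : 0 ≤ 1 - s * ρ := by nlinarith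
        positivity
      have h4 : 0 ≤ ρ - κ * (1 + s - s * ρ) := by nlinarith
      have := mul_nonneg (sub_nonneg.2 hs1) h4
      nlinarith

end Exponent

/-! ### The exponent of the maximum weight spanning tree -/

section Noisy

variable {p : ℕ} {θ : ℝ} {T : SimpleGraph (Fin p)} {P : (Fin p → Fin 2) → ℝ}
  {Ω : Type*} [MeasurableSpace Ω] {μ : Measure Ω} [IsProbabilityMeasure μ]

theorem agreementWeight_le_iff {n : ℕ} (hn : n ≠ 0) (y : ℕ → Fin p → Fin 2) (u v i k : Fin p) :
    agreementWeight (fun m : Fin n => y m) s(u, v) ≤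
        agreementWeight (fun m : Fin n => y m) s(i, k) ↔
      0 ≤ ∑ m ∈ Finset.range n, crossStep u v i k (y m) := by
  have hn' : (0 : ℝ) < 1 / (n : ℝ) := by
    have : (0 : ℝ) < n := by exact_mod_cast Nat.pos_of_ne_zero hn
    positivity
  rw [← sub_nonneg, agreementWeight_sub, mul_nonneg_iff_of_pos_left hn', Int.cast_nonneg_iff]

theorem agreementWeight_lt_iff {n : ℕ} (hn : n ≠ 0) (y : ℕ → Fin p → Fin 2) (u v i k : Fin p) :
    agreementWeight (fun m : Fin n => y m) s(u, v) <
        agreementWeight (fun m : Fin n => y m) s(i, k) ↔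
      0 < ∑ m ∈ Finset.range n, crossStep u v i k (y m) := by
  have hn' : (0 : ℝ) < 1 / (n : ℝ) := by
    have : (0 : ℝ) < n := by exact_mod_cast Nat.pos_of_ne_zero hn
    positivity
  rw [← sub_pos, agreementWeight_sub, mul_pos_iff_of_pos_left hn', Int.cast_pos]

theorem hasErrorExponent_of_isMWST (hp : 2 < p) (hθ₀ : 0 < θ) (hθ₁ : θ < 1 / 2)
    (hP : IsTreeModel θ T P) {q : ℝ} (hq₀ : 0 ≤ q) (hq₁ : q < 1 / 2)
    {Y : ℕ → Ω → Fin p → Fin 2} (hY : IsIIDSample μ (bscOutput q P) Y)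
    {E : ℕ → Ω → SimpleGraph (Fin p)}
    (hE : ∀ n, ∀ᵐ ω ∂μ, IsMWST (agreementWeight fun k : Fin n => Y k ω) (E n ω)) :
    HasErrorExponent μ T E (noisyExponent q θ) := by
  classical
  have hT := hP.isTree
  have ha₀ := two_mul_beta₂_pos hθ₀ hq₀ hq₁
  have hab := two_mul_beta₂_lt hθ₀ hθ₁ hq₁
  have hsum := two_mul_beta_add_lt (q := q) hθ₁ hq₁
  have hb₀ := ha₀.trans hab
  obtain ⟨i₀, j₀, k₀, hij, hjk, hik⟩ := hT.connected.exists_two_adj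
    (a := (⟨0, by omega⟩ : Fin p)) (b := ⟨1, by omega⟩) (c := ⟨2, by omega⟩)
    (by simp) (by simp) (by simp)
  obtain ⟨hk₀, hup, hdown⟩ := crossStep_moments_two_adj hP q hij hjk hik
  rw [noisyExponent_eq (by linarith) (by linarith)]
  have hG : 0 < 1 - (√(2 * beta₁ q θ) - √(2 * beta₂ q θ)) ^ 2 := by
    rw [sub_sq, Real.sq_sqrt hb₀.le, Real.sq_sqrt ha₀.le]
    have : 0 ≤ 2 * √(2 * beta₁ q θ) * √(2 * beta₂ q θ) := by positivity
    linarith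
  set Q : Finset (Fin p × Fin p × Fin p × Fin p) := Finset.univ.filter fun t =>
    T.Adj t.1 t.2.1 ∧ t.2.2.1 ∈ edgeSide T t.1 t.2.1 ∧ t.2.2.2 ∉ edgeSide T t.1 t.2.1 ∧
      s(t.2.2.1, t.2.2.2) ≠ s(t.1, t.2.1) with hQ
  refine tendsto_neg_inv_mul_log (c := (2 * beta₂ q θ) ^ 2) (K := Q.card) hG (by positivity) ?_ ?_
  · intro n hn
    refine (hY.measureReal_crossing_ge hup hdown ha₀ hb₀ (by linarith) hn).trans ?_
    refine ENNReal.toReal_mono (measure_ne_top _ _) (measure_mono_ae ?_)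
    filter_upwards [hE n] with ω hω hpos hET
    rw [hET] at hω
    exact absurd (hω.weight_le hij left_mem_edgeSide hk₀)
      (not_le.2 ((agreementWeight_lt_iff hn (fun m => Y m ω) _ _ _ _).2 hpos))
  · intro n hn
    have h1 : μ.real {ω | E n ω ≠ T} ≤ μ.real (⋃ t ∈ Q,
        {ω | 0 ≤ ∑ m ∈ Finset.range n, crossStep t.1 t.2.1 t.2.2.1 t.2.2.2 (Y m ω)}) := by
      refine ENNReal.toReal_mono (measure_ne_top _ _) (measure_mono_ae ?_)
      filter_upwards [hE n] with ω hω hne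
      obtain ⟨u, v, i, k, hadj, hi, hk, hne', hle⟩ := hω.exists_crossing hT hne
      refine Set.mem_biUnion (x := (u, v, i, k)) ?_
        ((agreementWeight_le_iff hn (fun m => Y m ω) _ _ _ _).1 hle)
      simp only [hQ, Finset.coe_filter, Finset.mem_univ, true_and, Set.mem_ofPred_eq]
      exact ⟨hadj, hi, hk, hne'⟩
    refine h1.trans ((measureReal_biUnion_finset_le _ _).trans ?_)
    rw [← nsmul_eq_mul]
    refine Finset.sum_le_card_nsmul _ _ _ fun t ht => ?_
    obtain ⟨hadj, hi, hk, hne'⟩ := (Finset.mem_filter.1 ht).2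
    obtain ⟨κ, C, hκ, hC, ha, hb⟩ := exists_crossStep_moments hθ₀ hθ₁ hP q hadj hi hk hne'
    -- The same tilt, optimal for the dominant crossing, is used for every crossing.
    have hr : 1 ≤ √(2 * beta₁ q θ / (2 * beta₂ q θ)) := by
      rw [Real.one_le_sqrt, one_le_div ha₀]
      exact hab.le
    have h2 := crossing_chernoff_le hθ₀ hθ₁ hq₀ hq₁ hκ hC ha hb
    have hD : ∀ y, 0 ≤ bscOutput q P y := fun y => by
      rw [← hY.law 0 y]
      exact measureReal_nonneg
    refine (hY.measureReal_crossing_le rfl rfl hr n).trans (pow_le_pow_left₀ ?_ h2 n)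
    have hle : ∑ y with crossStep t.1 t.2.1 t.2.2.1 t.2.2.2 y = 1, bscOutput q P y +
        ∑ y with crossStep t.1 t.2.1 t.2.2.1 t.2.2.2 y = -1, bscOutput q P y ≤ 1 := by
      rw [← Finset.sum_union, ← hY.sum_eq_one]
      · exact Finset.sum_le_sum_of_subset_of_nonneg (Finset.subset_univ _) fun y _ _ => hD y
      · rw [Finset.disjoint_filter]
        intro y _ h
        omega
    have hA := Finset.sum_nonneg (s := Finset.univ.filter fun y =>
      crossStep t.1 t.2.1 t.2.2.1 t.2.2.2 y = 1) fun y _ => hD y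
    have hB := Finset.sum_nonneg (s := Finset.univ.filter fun y =>
      crossStep t.1 t.2.1 t.2.2.1 t.2.2.2 y = -1) fun y _ => hD y
    have h5 : 0 ≤ √(2 * beta₁ q θ / (2 * beta₂ q θ)) := Real.sqrt_nonneg _
    have h6 := mul_nonneg hA h5
    have h7 := div_nonneg hB h5
    linarith

end Noisy

/-! ### Maximum likelihood reduces to maximum weight -/

section MaximumLikelihood

variable {p n : ℕ} {θ : ℝ} {T G : SimpleGraph (Fin p)} {Q : (Fin p → Fin 2) → ℝ}

/-- Needed so that a likelihood maximizer competes against every tree. -/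
theorem exists_isTreeModel (hθ₀ : 0 < θ) (hθ₁ : θ < 1 / 2) (hT : T.IsTree) :
    ∃ Q, IsTreeModel θ T Q := by
  classical
  have hF : ∀ e, e ∈ T.edgeFinset ↔ e ∈ T.edgeSet := fun e => SimpleGraph.mem_edgeFinset
  obtain ⟨Q, hQ⟩ : ∃ Q : (Fin p → Fin 2) → ℝ, ∀ x, Q x =
      (1 / 2) ^ p * ∏ e ∈ T.edgeFinset, (1 + (1 - 2 * θ) * edgeSpin x e) := ⟨_, fun _ => rfl⟩
  have hexp : ∀ φ : (Fin p → Fin 2) → ℝ,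
      ∑ x, φ x * Q x = isingExp (1 - 2 * θ) T.edgeFinset φ := by
    intro φ
    rw [isingExp, Finset.mul_sum, Fintype.card_fin]
    refine Finset.sum_congr rfl fun x _ => ?_
    rw [hQ]
    ring
  have hone : ∑ x, Q x = 1 := by
    have h := hexp fun _ => 1
    rw [isingExp_one hT.isAcyclic fun e => (hF e).1] at h
    simpa using h
  have hspin : ∀ i, ∑ x, spin (x i) * Q x = 0 := by
    intro i
    rw [hexp]
    -- The global flip preserves all edge products and negates a single spin.
    exact isingExp_eq_zero (U := Set.univ) (by simp) fun x =>
      spin_flipOn_of_mem (Set.mem_univ i) x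
  have hnode : ∀ i a, nodeMarginal Q i a = 1 / 2 := by
    intro i a
    have h : nodeMarginal Q i a = (∑ x, Q x + spin a * ∑ x, spin (x i) * Q x) / 2 := by
      rw [nodeMarginal, Finset.sum_filter, Finset.mul_sum, ← Finset.sum_add_distrib,
        Finset.sum_div]
      refine Finset.sum_congr rfl fun x _ => ?_
      have key : ∀ (c a : Fin 2) (d : ℝ),
          (if c = a then d else 0) = (d + spin a * (spin c * d)) / 2 := by
        simp [Fin.forall_fin_two, spin]
      exact key _ _ _
    rw [h, hone, hspin]
    norm_num
  have hpair : ∀ i j, T.Adj i j → pairMarginal Q i j 0 1 = θ / 2 ∧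
      pairMarginal Q i j 1 0 = θ / 2 := by
    intro i j hadj
    have h : ∀ a b, pairMarginal Q i j a b = (∑ x, Q x + spin a * ∑ x, spin (x i) * Q x
        + spin b * ∑ x, spin (x j) * Q x
        + spin a * spin b * ∑ x, spin (x i) * spin (x j) * Q x) / 4 := by
      intro a b
      rw [pairMarginal, Finset.sum_filter, Finset.mul_sum, Finset.mul_sum, Finset.mul_sum,
        ← Finset.sum_add_distrib, ← Finset.sum_add_distrib, ← Finset.sum_add_distrib,
        Finset.sum_div]
      refine Finset.sum_congr rfl fun x _ => ?_
      have key : ∀ (c c' a b : Fin 2) (d : ℝ), (if c = a ∧ c' = b then d else 0) =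
          (d + spin a * (spin c * d) + spin b * (spin c' * d)
            + spin a * spin b * (spin c * spin c' * d)) / 4 := by
        simp only [Fin.forall_fin_two, spin]
        norm_num
        ring_nf
        simp
      exact key _ _ _ _ _
    rw [h, h, hone, hspin, hspin, hexp, isingExp_edge hT.isAcyclic hF hadj]
    simp only [spin]
    norm_num
    ring
  refine ⟨Q, hT, ⟨fun x => ?_, hone⟩, fun x => ?_, hnode, hpair⟩
  · rw [hQ]
    exact mul_nonneg (by positivity) (Finset.prod_nonneg fun e _ =>
      one_add_mul_edgeSpin_nonneg (by linarith) (by linarith) x e)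
  · rw [hQ]
    congr 1
    · simp [hnode]
    · refine Finset.prod_congr (by ext e; simp) fun e he => ?_
      rw [SimpleGraph.mem_edgeFinset] at he
      induction e with
      | h i j => exact (edgeFactor_of_marginals hnode (hpair i j he) x).symm

/-- The log-likelihood of a tree model is an increasing affine function of the weight of its
tree. -/
theorem IsTreeModel.sum_log (hθ₀ : 0 < θ) (hθ₁ : θ < 1 / 2) (hQ : IsTreeModel θ G Q)
    (hn : n ≠ 0) (x : Fin n → Fin p → Fin 2) :
    ∑ m, Real.log (Q (x m)) = n * (p * Real.log (1 / 2) + (p - 1) * Real.log (2 * θ) +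
      (Real.log (2 * (1 - θ)) - Real.log (2 * θ)) * graphWeight (agreementWeight x) G) := by
  classical
  have hn' : (n : ℝ) ≠ 0 := by exact_mod_cast hn
  have hF : ∀ e, e ∈ G.edgeFinset ↔ e ∈ G.edgeSet := fun e => SimpleGraph.mem_edgeFinset
  have hpos : ∀ (y : Fin p → Fin 2) e, 1 + (1 - 2 * θ) * edgeSpin y e ≠ 0 := by
    intro y e
    have := (abs_le.1 (abs_edgeSpin y e).le).1
    have : 0 < 1 + (1 - 2 * θ) * edgeSpin y e := by nlinarith
    exact this.ne'
  have hlog : ∀ y, Real.log (Q y) = p * Real.log (1 / 2) +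
      ∑ e ∈ G.edgeFinset, Real.log (1 + (1 - 2 * θ) * edgeSpin y e) := by
    intro y
    rw [hQ.apply_eq hF, Real.log_mul (by positivity) (Finset.prod_ne_zero_iff.2 fun e _ =>
      hpos y e), Real.log_pow, Real.log_prod fun e _ => hpos y e]
  have hedge : ∀ e, ∑ m, Real.log (1 + (1 - 2 * θ) * edgeSpin (x m) e) =
      n * (Real.log (2 * θ) +
        (Real.log (2 * (1 - θ)) - Real.log (2 * θ)) * agreementWeight x e) := by
    intro e
    induction e with
    | h i j =>
      have key : ∀ c d : Fin 2, Real.log (1 + (1 - 2 * θ) * (spin c * spin d)) =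
          Real.log (2 * θ) +
            (Real.log (2 * (1 - θ)) - Real.log (2 * θ)) * (if c = d then 1 else 0) := by
        have e1 : 1 + (1 - 2 * θ) = 2 * (1 - θ) := by ring
        simp [Fin.forall_fin_two, spin, e1]
      simp only [edgeSpin_mk, key]
      rw [Finset.sum_add_distrib, ← Finset.mul_sum, agreementWeight_mk]
      simp only [Finset.sum_const, Finset.card_univ, Fintype.card_fin, nsmul_eq_mul]
      field_simp
  -- All trees have the same number of edges, so the constant part of the log-likelihood does not
  -- depend on the tree.
  have hcard : (G.edgeFinset.card : ℝ) = p - 1 := by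
    have := hQ.isTree.card_edgeFinset
    rw [Fintype.card_fin] at this
    rw [eq_sub_iff_add_eq]
    exact_mod_cast this
  have hw : graphWeight (agreementWeight x) G = ∑ e ∈ G.edgeFinset, agreementWeight x e := by
    rw [graphWeight]
  simp only [hlog]
  rw [Finset.sum_add_distrib, Finset.sum_comm]
  simp only [hedge]
  rw [← Finset.mul_sum (a := (n : ℝ)), Finset.sum_add_distrib,
    ← Finset.mul_sum (s := G.edgeFinset), ← hw]
  simp only [Finset.sum_const, Finset.card_univ, Fintype.card_fin, nsmul_eq_mul, hcard]
  ring

theorem IsMLTree.isMWST (hθ₀ : 0 < θ) (hθ₁ : θ < 1 / 2) {x : Fin n → Fin p → Fin 2}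
    (h : IsMLTree θ x G) : IsMWST (agreementWeight x) G := by
  obtain ⟨Q, hQ, hmax⟩ := h
  refine ⟨hQ.isTree, fun G' hG' => ?_⟩
  -- Without samples all weights vanish and every tree is optimal.
  rcases eq_or_ne n 0 with rfl | hn
  · have h0 : ∀ e, agreementWeight x e = 0 := by
      intro e
      induction e with
      | h i j => simp [agreementWeight_mk]
    simp [graphWeight, h0]
  · obtain ⟨Q', hQ'⟩ := exists_isTreeModel hθ₀ hθ₁ hG'
    have h1 := hmax G' Q' hQ'
    have hn' : (0 : ℝ) < n := by exact_mod_cast Nat.pos_of_ne_zero hn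
    rw [hQ.sum_log hθ₀ hθ₁ hn, hQ'.sum_log hθ₀ hθ₁ hn, mul_le_mul_iff_right₀ hn',
      add_le_add_iff_left] at h1
    have h2 : 0 < Real.log (2 * (1 - θ)) - Real.log (2 * θ) :=
      sub_pos.2 (Real.log_lt_log (by linarith) (by linarith))
    exact le_of_mul_le_mul_left h1 h2

end MaximumLikelihood

theorem mainTheorem4 {p : ℕ} (hp : 2 < p) {θ : ℝ} (hθ₀ : 0 < θ) (hθ₁ : θ < 1 / 2)
    {T : SimpleGraph (Fin p)} {P : (Fin p → Fin 2) → ℝ} (hP : IsTreeModel θ T P)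
    {Ω : Type*} [MeasurableSpace Ω] (μ : Measure Ω) [IsProbabilityMeasure μ] :
    (∀ q : ℝ, 0 ≤ q → q < 1 / 2 → ∀ Y : ℕ → Ω → Fin p → Fin 2,
      IsIIDSample μ (bscOutput q P) Y →
      ∀ E : ℕ → Ω → SimpleGraph (Fin p),
        (∀ n G, MeasurableSet {ω | E n ω = G}) →
        (∀ n, ∀ᵐ ω ∂μ, IsMWST (agreementWeight fun k : Fin n => Y k ω) (E n ω)) →
        HasErrorExponent μ T E (noisyExponent q θ)) ∧
    (∀ X : ℕ → Ω → Fin p → Fin 2,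
      IsIIDSample μ P X →
      ∀ E : ℕ → Ω → SimpleGraph (Fin p),
        (∀ n G, MeasurableSet {ω | E n ω = G}) →
        (∀ n, ∀ᵐ ω ∂μ, IsMLTree θ (fun k : Fin n => X k ω) (E n ω)) →
        HasErrorExponent μ T E (noisyExponent 0 θ)) ∧
    noisyExponent 0 θ = -Real.log (1 - θ * (1 - √(4 * θ * (1 - θ)))) := by
  refine ⟨fun q hq₀ hq₁ Y hY E _ hE => hasErrorExponent_of_isMWST hp hθ₀ hθ₁ hP hq₀ hq₁ hY hE,
    fun X hX E _ hE => ?_, noisyExponent_zero hθ₀⟩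
  refine hasErrorExponent_of_isMWST hp hθ₀ hθ₁ hP le_rfl (by norm_num)
    (by rwa [bscOutput_zero]) fun n => ?_
  filter_upwards [hE n] with ω hω using hω.isMWST hθ₀ hθ₁
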